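/- **Setting.** Let $\mathcal M,\mathcal U,\mathcal Y$ be finite-dimensional smooth manifolds without boundary, $\mathcal M$ Hausdorff of dimension $d_{\mathcal M}$, let $\mathcal W=\mathcal U\times\mathcal Y$, and let $F:T\mathcal M\times\mathcal W\to\mathbb R^m$ be $C^1$. Fix the time domain $J=\mathbb R$ or $J=[0,\infty)$. The system $\Sigma$ is the set of $C^2$ curves $(x,u,y):J\to\mathcal M\times\mathcal U\times\mathcal Y$ (on $[0,\infty)$: restrictions of $C^2$ curves on $\mathbb R$) with $F(x(t),\dot x(t),u(t),y(t))=0$ for all $t\in J$. Assume that $\Sigma$ is well-posed: for each $C^2$ input $u$ there are $C^2$ maps $\varphi:\mathbb R\times\mathcal M\to\mathcal M$ and $\eta:\mathbb R\times\mathcal M\to\mathcal Y$ such that for every $x_0\in\mathcal M$ one has $\varphi(0,x_0)=x_0$ and $(\varphi(\cdot,x_0),u,\eta(\cdot,x_0))\in\Sigma$; and the state curve $x$ of an element of $\Sigma$ is determined on $J$ by $x(0)$ and $u|_J$. The displacement system $\delta\Sigma$ is the set of $C^1$ curves $(x,\delta x,u,\delta u,y,\delta y):J\to T\mathcal M\times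 T\mathcal U\times T\mathcal Y$ (with the same convention on $[0,\infty)$) such that $(x,u,y)\in\Sigma$ and $DF(x,\dot x,u,y)[\delta x,\dot{\delta x},\delta u,\delta y]=0$ for all $t\in J$ (in local coordinates). **Storage.** Let $\Omega\subseteq\mathcal M$ be a set all of whose points are isolated in $\Omega$, let $T_x\mathcal M=\mathcal V_x\oplus\mathcal H_x$ for each $x$, where $\mathcal V$ and $\mathcal H$ are locally spanned by $r$ and $q$ vector fields of class $C^1$, respectively, with $0\le r<d_{\mathcal M}$ and $0<q\le d_{\mathcal M}-r$. Let $S,K:T\mathcal M\to\mathbb R_{\ge0}$, $p\ge1$, $c_1,c_2\ge0$ satisfy $c_1K^p\le S\le c_2K^p$ on $T\mathcal M$ and (i) $S$ and $K$ are $C^1$ at $(x,\delta x)$ for each $x\in\mathcal M$ and $\delta x\in\mathcal H_x\setminus\{0\}$; (ii) $S(x,\delta x_h+\delta x_v)=S(x,\delta x_h)$ and $K(x,\delta x_h+\delta x_v)=K(x,\delta x_h)$ for $\delta x_h\in\mathcal H_x$, $\delta x_v\in\mathcal V_x$; (iii) $K(x,\delta x)>0$ for $x\in\mathcal M\setminus\Omega$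 and $\delta x\in\mathcal H_x\setminus\{0\}$; (iv) $K(x,\lambda\delta x)=\lambda K(x,\delta x)$ for $\lambda>0$, $x\in\mathcal M$, $\delta x\in\mathcal H_x$; (v) $K(x,\delta x_1+\delta x_2)<K(x,\delta x_1)+K(x,\delta x_2)$ for $x\in\mathcal M\setminus\Omega$ and $\delta x_1,\delta x_2\in\mathcal H_x\setminus\{0\}$ such that $\delta x_1\ne\lambda\delta x_2$ for all $\lambda\in\mathbb R$. **Dissipativity.** Let $Q:\mathcal M\times T\mathcal U\times T\mathcal Y\to\mathbb R$ be such that, along every element of $\delta\Sigma$, the function $\tau\mapsto Q(x,u,\delta u,y,\delta y)(\tau)$ is integrable on $[0,t]$ for each $t\ge0$ and $$S(x(t),\delta x(t))-S(x(0),\delta x(0))\le\int_0^tQ(x,u,\delta u,y,\delta y)(\tau)\,d\tau .$$ Suppose that $Q=0$ whenever $\delta u=0$. **Distances.** For $N:T\mathcal M\to\mathbb R_{\ge0}$ let $d_N(a,b)\in[0,\infty]$ be the infimum of $\int_0^1N(\gamma(s),\gamma'(s))\,ds$ over the piecewise $C^1$ curves $\gamma:[0,1]\to\mathcal M$ from $a$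 to $b$. Call $d_N$ a pseudo-distance if $d_N(a,a)=0$, $d_N(a,c)\le d_N(a,b)+d_N(b,c)$, and $d_N(a,b)<\infty$ for $a,b$ in the same connected component (symmetry is not required). A function $\alpha:\mathbb R_{\ge0}\to\mathbb R_{\ge0}$ is of class $\mathcal K$ if it is locally Lipschitz and strictly increasing with $\alpha(0)=0$. Say that $\Sigma$ is incrementally stable for $d$ if there is a class $\mathcal K$ function $\alpha$ such that $$d(x_1(t),x_2(t))\le\alpha\bigl(d(x_1(0),x_2(0))\bigr)\qquad\text{for all }t\ge0$$ and all $(x_1,u_1,y_1),(x_2,u_2,y_2)\in\Sigma$ with $u_1=u_2$ on $J$ and $d(x_1(0),x_2(0))<\infty$ (which is automatic for a pseudo-distance if $\mathcal M$ is connected). **Theorem.** 1. $\Sigma$ is incrementally stable for $d=d_{S^{1/p}}$. If $S(x,\lambda\delta x)=\lambda^pS(x,\delta x)$ for all $\lambda>0$, $x\in\mathcal M$, $\delta x\in\mathcal H_x$, then $d$ is a pseudo-distance. If $c_1>0$ and $\mathcal H_x=T_x\mathcal M$ for all $x$, then $d(a,b)=0$ only if $a=b$. 2. $d_K$ is a pseudo-distance.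 If $c_1>0$, then $\Sigma$ is incrementally stable for $d_K$. If $\mathcal H_x=T_x\mathcal M$ for all $x$, then $d_K(a,b)=0$ only if $a=b$. -/

import Mathlib

open Set Filter Topology MeasureTheory
open scoped Manifold ContDiff NNReal

noncomputable section

namespace DiffDissipativity

/-- A function `α : ℝ≥0 → ℝ≥0` of class `𝒦`. -/
structure IsClassK (α : ℝ≥0 → ℝ≥0) : Prop where
  locallyLipschitz : LocallyLipschitz α
  strictMono : StrictMono α
  map_zero : α 0 = 0

section Curves

variable (E : Type*) [NormedAddCommGroup E] [NormedSpace ℝ E]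
  {M : Type*} [TopologicalSpace M] [ChartedSpace E M]

/-- The lift `t ↦ (x(t), ẋ(t))` of a curve `x` in `M` to the tangent bundle, where
`ẋ(t) = Dx(t)[1]`. -/
def liftCurve (x : ℝ → M) (t : ℝ) : TangentBundle 𝓘(ℝ, E) M :=
  ⟨x t, mfderiv 𝓘(ℝ, ℝ) 𝓘(ℝ, E) x t (1 : ℝ)⟩

/-- `γ` is piecewise `C¹` on `[0,1]`: for some subdivision `0 = τ₀ ≤ τ₁ ≤ ⋯ ≤ τₙ = 1`, the curve
is `C¹` on each closed interval `[τᵢ, τᵢ₊₁]` (in particular it is continuous on `[0,1]`). Values of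
`γ` outside `[0,1]` play no role. -/
def IsPiecewiseC1 (γ : ℝ → M) : Prop :=
  ∃ (n : ℕ) (τ : ℕ → ℝ), Monotone τ ∧ τ 0 = 0 ∧ τ n = 1 ∧
    ∀ i < n, ContMDiffOn 𝓘(ℝ, ℝ) 𝓘(ℝ, E) 1 γ (Icc (τ i) (τ (i + 1)))

variable {E}

/-- The length `∫₀¹ N(γ(s), Dγ(s)[1]) ds` of a curve with respect to a nonnegative function `N` on
the tangent bundle. The finitely many corners of a piecewise `C¹` curve form a null set. -/
def curveLength (N : TangentBundle 𝓘(ℝ, E) M → ℝ) (γ : ℝ → M) : ENNReal :=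
  ∫⁻ s in Icc (0 : ℝ) 1, ENNReal.ofReal (N (liftCurve E γ s))

/-- The pseudo-distance induced by `N`: the infimum of the lengths of the piecewise `C¹` curves
`[0,1] → M` from `a` to `b` (it is `⊤` if there is no such curve). -/
def inducedDist (N : TangentBundle 𝓘(ℝ, E) M → ℝ) (a b : M) : ENNReal :=
  ⨅ (γ : ℝ → M) (_ : IsPiecewiseC1 E γ ∧ γ 0 = a ∧ γ 1 = b), curveLength N γ

end Curves

/-- A (not necessarily symmetric) pseudo-distance on `M`, which is finite between any two points
of the same connected component. -/
structure IsPseudoDistance {M : Type*} [TopologicalSpace M] (d : M → M → ENNReal) : Prop where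
  self : ∀ a, d a a = 0
  triangle : ∀ a b c, d a c ≤ d a b + d b c
  finite : ∀ a b, b ∈ connectedComponent a → d a b ≠ ⊤

/-- Points at `d`-distance zero coincide. -/
def Separates {M : Type*} (d : M → M → ENNReal) : Prop :=
  ∀ a b, d a b = 0 → a = b

section Storage

variable {E : Type*} [NormedAddCommGroup E] [NormedSpace ℝ E]
  {M : Type*} [TopologicalSpace M] [ChartedSpace E M] [IsManifold 𝓘(ℝ, E) ∞ M]

/-- The family of subspaces `D x ⊆ TₓM` is, near each point, spanned by `k` vector fields of
class `C¹`. -/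
def IsSpannedByC1Fields (k : ℕ) (D : (x : M) → Submodule ℝ (TangentSpace 𝓘(ℝ, E) x)) : Prop :=
  ∀ x₀ : M, ∃ O : Set M, IsOpen O ∧ x₀ ∈ O ∧
    ∃ v : Fin k → (x : M) → TangentSpace 𝓘(ℝ, E) x,
      (∀ i, ContMDiffOn 𝓘(ℝ, E) 𝓘(ℝ, E).tangent 1
        (fun x => (⟨x, v i x⟩ : TangentBundle 𝓘(ℝ, E) M)) O) ∧
      ∀ x ∈ O, D x = Submodule.span ℝ (Set.range fun i => v i x)

/-- A subdivision of the tangent spaces into a vertical distribution `V` and a complementary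
horizontal distribution `H`. -/
structure IsSubdivision (V H : (x : M) → Submodule ℝ (TangentSpace 𝓘(ℝ, E) x)) : Prop where
  spanned : ∃ r q : ℕ, r < Module.finrank ℝ E ∧ 0 < q ∧ r + q ≤ Module.finrank ℝ E ∧
    IsSpannedByC1Fields r V ∧ IsSpannedByC1Fields q H
  isCompl : ∀ x, IsCompl (V x) (H x)

/-- `S` is a differential storage function, with exceptional set `Ω` of isolated points, vertical
and horizontal distributions `V` and `H`, Finsler-type function `K`, exponent `p`, and
constants `c₁`, `c₂`. -/
structure IsDifferentialStorage (Ω : Set M)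
    (V H : (x : M) → Submodule ℝ (TangentSpace 𝓘(ℝ, E) x))
    (S K : TangentBundle 𝓘(ℝ, E) M → ℝ) (p c₁ c₂ : ℝ) : Prop where
  isolated : DiscreteTopology Ω
  subdivision : IsSubdivision V H
  one_le_p : 1 ≤ p
  c₁_nonneg : 0 ≤ c₁
  c₂_nonneg : 0 ≤ c₂
  S_nonneg : ∀ ξ, 0 ≤ S ξ
  K_nonneg : ∀ ξ, 0 ≤ K ξ
  lower : ∀ ξ, c₁ * K ξ ^ p ≤ S ξ
  upper : ∀ ξ, S ξ ≤ c₂ * K ξ ^ p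
  S_contMDiffAt : ∀ (x : M), ∀ δ ∈ H x, δ ≠ 0 →
    ContMDiffAt 𝓘(ℝ, E).tangent 𝓘(ℝ, ℝ) 1 S ⟨x, δ⟩
  K_contMDiffAt : ∀ (x : M), ∀ δ ∈ H x, δ ≠ 0 →
    ContMDiffAt 𝓘(ℝ, E).tangent 𝓘(ℝ, ℝ) 1 K ⟨x, δ⟩
  S_horizontal : ∀ (x : M), ∀ δh ∈ H x, ∀ δv ∈ V x, S ⟨x, δh + δv⟩ = S ⟨x, δh⟩
  K_horizontal : ∀ (x : M), ∀ δh ∈ H x, ∀ δv ∈ V x, K ⟨x, δh + δv⟩ = K ⟨x, δh⟩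
  K_pos : ∀ x ∉ Ω, ∀ δ ∈ H x, δ ≠ 0 → 0 < K ⟨x, δ⟩
  K_homogeneous : ∀ (x : M), ∀ δ ∈ H x, ∀ l : ℝ, 0 < l → K ⟨x, l • δ⟩ = l * K ⟨x, δ⟩
  K_strictConvex : ∀ x ∉ Ω, ∀ δ₁ ∈ H x, ∀ δ₂ ∈ H x, δ₁ ≠ 0 → δ₂ ≠ 0 →
    (∀ l : ℝ, δ₁ ≠ l • δ₂) → K ⟨x, δ₁ + δ₂⟩ < K ⟨x, δ₁⟩ + K ⟨x, δ₂⟩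

/-- `S` is positively homogeneous of degree `p` on the horizontal distribution. -/
def IsHomogeneousOfDegree (H : (x : M) → Submodule ℝ (TangentSpace 𝓘(ℝ, E) x))
    (S : TangentBundle 𝓘(ℝ, E) M → ℝ) (p : ℝ) : Prop :=
  ∀ (x : M), ∀ δ ∈ H x, ∀ l : ℝ, 0 < l → S ⟨x, l • δ⟩ = l ^ p * S ⟨x, δ⟩

end Storage

section Systems

variable {E : Type*} [NormedAddCommGroup E] [NormedSpace ℝ E]
  {M : Type*} [TopologicalSpace M] [ChartedSpace E M] [IsManifold 𝓘(ℝ, E) ∞ M]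
  {E₁ : Type*} [NormedAddCommGroup E₁] [NormedSpace ℝ E₁]
  {U : Type*} [TopologicalSpace U] [ChartedSpace E₁ U] [IsManifold 𝓘(ℝ, E₁) ∞ U]
  {E₂ : Type*} [NormedAddCommGroup E₂] [NormedSpace ℝ E₂]
  {Y : Type*} [TopologicalSpace Y] [ChartedSpace E₂ Y] [IsManifold 𝓘(ℝ, E₂) ∞ Y]
  {m : ℕ}

variable (E₁ E₂) in
/-- The behavior of the system `F(x, ẋ, (u, y)) = 0` on the time domain `J`, which is `ℝ` or
`[0, ∞)`: the `C²` curves that satisfy the equation at each time of `J`. Curves on `[0, ∞)` are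
represented by `C²` extensions to `ℝ`, which determine the derivative at the end point `0`; the
values at negative times then play no role. -/
structure InBehavior (F : TangentBundle 𝓘(ℝ, E) M × (U × Y) → EuclideanSpace ℝ (Fin m))
    (J : Set ℝ) (x : ℝ → M) (u : ℝ → U) (y : ℝ → Y) : Prop where
  state : ContMDiff 𝓘(ℝ, ℝ) 𝓘(ℝ, E) 2 x
  input : ContMDiff 𝓘(ℝ, ℝ) 𝓘(ℝ, E₁) 2 u
  output : ContMDiff 𝓘(ℝ, ℝ) 𝓘(ℝ, E₂) 2 y
  equation : ∀ t ∈ J, F (liftCurve E x t, (u t, y t)) = 0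

variable (E₁ E₂) in
/-- Well-posedness of the input-output system: for each `C²` input there are solutions, existing
on the whole time domain, from each initial condition, which depend on time and on the
initial condition in a `C²` way, and the state of a solution is determined by the
initial condition and the input. -/
structure IsWellPosed (F : TangentBundle 𝓘(ℝ, E) M × (U × Y) → EuclideanSpace ℝ (Fin m))
    (J : Set ℝ) : Prop where
  existence : ∀ u : ℝ → U, ContMDiff 𝓘(ℝ, ℝ) 𝓘(ℝ, E₁) 2 u →
    ∃ (φ : ℝ × M → M) (η : ℝ × M → Y),
      ContMDiff (𝓘(ℝ, ℝ).prod 𝓘(ℝ, E)) 𝓘(ℝ, E) 2 φ ∧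
      ContMDiff (𝓘(ℝ, ℝ).prod 𝓘(ℝ, E)) 𝓘(ℝ, E₂) 2 η ∧
      ∀ x₀ : M, φ (0, x₀) = x₀ ∧
        InBehavior E₁ E₂ F J (fun t => φ (t, x₀)) u (fun t => η (t, x₀))
  uniqueness : ∀ (x x' : ℝ → M) (u u' : ℝ → U) (y y' : ℝ → Y),
    InBehavior E₁ E₂ F J x u y → InBehavior E₁ E₂ F J x' u' y' →
    EqOn u u' J → x 0 = x' 0 → EqOn x x' J

/-- `DF(x, ẋ, w)[δx, δẋ, δw]` at time `t`, for curves `ξ = (x, δx)`, `μ = (u, δu)`, `ν = (y, δy)`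
in the tangent bundles. The tangent space of `TM` at a point over `x(t)` is `E × E`, through the
chart of `TM` induced by the preferred chart of `M` at `x(t)`. That chart serves for both points
`(x, δx)` and `(x, ẋ)` of `TM`. In it the velocity of `ξ` has the components `(ẋ, δẋ)`, and the
tangent vector at `(x, ẋ)` to which `DF` is applied has the components `(δx, δẋ)`. -/
def displacementEq (F : TangentBundle 𝓘(ℝ, E) M × (U × Y) → EuclideanSpace ℝ (Fin m))
    (ξ : ℝ → TangentBundle 𝓘(ℝ, E) M) (μ : ℝ → TangentBundle 𝓘(ℝ, E₁) U)
    (ν : ℝ → TangentBundle 𝓘(ℝ, E₂) Y) (t : ℝ) : EuclideanSpace ℝ (Fin m) :=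
  let velocity : E × E := mfderiv 𝓘(ℝ, ℝ) 𝓘(ℝ, E).tangent ξ t (1 : ℝ)
  let δx : E := (ξ t).snd
  let δu : E₁ := (μ t).snd
  let δy : E₂ := (ν t).snd
  mfderiv (𝓘(ℝ, E).tangent.prod (𝓘(ℝ, E₁).prod 𝓘(ℝ, E₂))) 𝓘(ℝ, EuclideanSpace ℝ (Fin m)) F
    (liftCurve E (fun s => (ξ s).proj) t, ((μ t).proj, (ν t).proj))
    ((δx, velocity.2), (δu, δy))

/-- The displacement dynamical system: the `C¹` curves `ξ = (x, δx)`, `μ = (u, δu)`,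
`ν = (y, δy)` over a curve `(x, u, y)` of the behavior that satisfy the linearized
equation. -/
structure InDisplacement (F : TangentBundle 𝓘(ℝ, E) M × (U × Y) → EuclideanSpace ℝ (Fin m))
    (J : Set ℝ) (ξ : ℝ → TangentBundle 𝓘(ℝ, E) M) (μ : ℝ → TangentBundle 𝓘(ℝ, E₁) U)
    (ν : ℝ → TangentBundle 𝓘(ℝ, E₂) Y) : Prop where
  base : InBehavior E₁ E₂ F J (fun t => (ξ t).proj) (fun t => (μ t).proj) (fun t => (ν t).proj)
  state : ContMDiff 𝓘(ℝ, ℝ) 𝓘(ℝ, E).tangent 1 ξ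
  input : ContMDiff 𝓘(ℝ, ℝ) 𝓘(ℝ, E₁).tangent 1 μ
  output : ContMDiff 𝓘(ℝ, ℝ) 𝓘(ℝ, E₂).tangent 1 ν
  equation : ∀ t ∈ J, displacementEq F ξ μ ν t = 0

/-- `Q(x, (u, δu), (y, δy))` is a differential supply rate. -/
def IsDifferentialSupplyRate
    (F : TangentBundle 𝓘(ℝ, E) M × (U × Y) → EuclideanSpace ℝ (Fin m)) (J : Set ℝ)
    (Q : M → TangentBundle 𝓘(ℝ, E₁) U → TangentBundle 𝓘(ℝ, E₂) Y → ℝ) : Prop :=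
  ∀ ξ μ ν, InDisplacement F J ξ μ ν → ∀ t, 0 ≤ t →
    IntervalIntegrable (fun τ => Q (ξ τ).proj (μ τ) (ν τ)) volume 0 t

/-- The dissipation inequality for `S` and `Q` along the displacement dynamical system. -/
def IsDissipationInequality
    (F : TangentBundle 𝓘(ℝ, E) M × (U × Y) → EuclideanSpace ℝ (Fin m)) (J : Set ℝ)
    (S : TangentBundle 𝓘(ℝ, E) M → ℝ)
    (Q : M → TangentBundle 𝓘(ℝ, E₁) U → TangentBundle 𝓘(ℝ, E₂) Y → ℝ) : Prop :=
  ∀ ξ μ ν, InDisplacement F J ξ μ ν → ∀ t, 0 ≤ t →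
    S (ξ t) - S (ξ 0) ≤ ∫ τ in (0 : ℝ)..t, Q (ξ τ).proj (μ τ) (ν τ)

variable (E₁ E₂) in
/-- Incremental stability with respect to `d`: a single class `𝒦` function bounds the distance of
any two solutions driven by the same input. -/
def IsIncrementallyStable
    (F : TangentBundle 𝓘(ℝ, E) M × (U × Y) → EuclideanSpace ℝ (Fin m)) (J : Set ℝ)
    (d : M → M → ENNReal) : Prop :=
  ∃ α : ℝ≥0 → ℝ≥0, IsClassK α ∧
    ∀ (x₁ x₂ : ℝ → M) (u₁ u₂ : ℝ → U) (y₁ y₂ : ℝ → Y),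
      InBehavior E₁ E₂ F J x₁ u₁ y₁ → InBehavior E₁ E₂ F J x₂ u₂ y₂ → EqOn u₁ u₂ J →
      d (x₁ 0) (x₂ 0) ≠ ⊤ →
      ∀ t, 0 ≤ t → d (x₁ t) (x₂ t) ≤ α (d (x₁ 0) (x₂ 0)).toNNReal

end Systems

end DiffDissipativity

end

/-! Fix an input `u` and let `φ_t` be the flow of the solutions driven by it. A tangent vector `z`
is the velocity at `σ = 0` of a curve `c`, and every `t ↦ φ_t(c(σ))` is a solution with the same
input. Differentiating `F = 0` in `σ` therefore yields an element of the displacement system with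
`δu = 0` (`inDisplacement_of_family`). Symmetry of second derivatives makes the variation of the
velocity equal to the velocity of the variation. Since `Q` vanishes for `δu = 0`, dissipativity says
`S(Dφ_t z) ≤ S(z)` (`storage_tangentMap_le`).

Hence pushing a curve forward by `φ_t` does not increase its length for `S^(1/p)`. For `K` the
two-sided comparison with `S` costs a factor `(c₂/c₁)^(1/p)`. Taking infima over curves, the flow is
Lipschitz for the induced distance, so a linear `α` works. Uniqueness identifies arbitrary solutions
with flow lines.

The metric properties do not involve the dynamics. Homogeneity of degree one makes length invariant
under reparametrization, which gives the triangle inequality by concatenation. Compactness of the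
unit sphere of horizontal coordinates bounds `K` locally by the norm
(`isLocallyBounded_of_horizontal`), so short chart segments have finite length and finiteness
propagates through connected components. For separation, a bump function `ρ` around `a` that
vanishes at `b` is constant near `a`, and its support meets `Ω` at most in `a`. So `|dρ| ≤ C K`
everywhere, even if `K` degenerates over `a`, and `1 = |ρ(b) - ρ(a)| ≤ C d(a,b)`. -/

noncomputable section

namespace DiffDissipativity

/-! ### Velocities in charts and the symmetry of mixed derivatives -/

section Lift

variable {E : Type*} [NormedAddCommGroup E] [NormedSpace ℝ E]
  {M : Type*} [TopologicalSpace M] [ChartedSpace E M] [IsManifold 𝓘(ℝ, E) ∞ M]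

theorem trivializationAt_snd_eq_mfderiv (p : M) (z : TangentBundle 𝓘(ℝ, E) M)
    (hz : z.proj ∈ (chartAt E p).source) :
    (trivializationAt E (TangentSpace 𝓘(ℝ, E)) p z).2 =
      mfderiv 𝓘(ℝ, E) 𝓘(ℝ, E) (extChartAt 𝓘(ℝ, E) p) z.proj z.2 := by
  have : IsManifold 𝓘(ℝ, E) 1 M := IsManifold.of_le (n := ∞) (by simp)
  refine Eq.trans ?_ (DFunLike.congr_fun
    (TangentBundle.continuousLinearMapAt_trivializationAt (I := 𝓘(ℝ, E)) hz) z.2)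
  rw [Bundle.Trivialization.continuousLinearMapAt_apply,
    Bundle.Trivialization.coe_linearMapAt_of_mem]
  simpa using hz

theorem mfderiv_extChartAt_comp_apply_one {p : M} {x : ℝ → M} {t : ℝ}
    (hx : MDifferentiableAt 𝓘(ℝ, ℝ) 𝓘(ℝ, E) x t) (ht : x t ∈ (chartAt E p).source) :
    mfderiv 𝓘(ℝ, E) 𝓘(ℝ, E) (extChartAt 𝓘(ℝ, E) p) (x t)
      (mfderiv 𝓘(ℝ, ℝ) 𝓘(ℝ, E) x t (1 : ℝ)) = deriv (extChartAt 𝓘(ℝ, E) p ∘ x) t := by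
  have : IsManifold 𝓘(ℝ, E) 1 M := IsManifold.of_le (n := ∞) (by simp)
  have h := mfderiv_comp t (mdifferentiableAt_extChartAt (I := 𝓘(ℝ, E)) ht) hx
  have h2 : mfderiv 𝓘(ℝ, ℝ) 𝓘(ℝ, E) (extChartAt 𝓘(ℝ, E) p ∘ x) t (1 : ℝ)
      = deriv (extChartAt 𝓘(ℝ, E) p ∘ x) t := by
    rw [mfderiv_eq_fderiv]
    rfl
  rw [← h2, h]
  rfl

theorem trivializationAt_liftCurve {p : M} {x : ℝ → M} {t : ℝ}
    (hx : MDifferentiableAt 𝓘(ℝ, ℝ) 𝓘(ℝ, E) x t) (ht : x t ∈ (chartAt E p).source) :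
    (trivializationAt E (TangentSpace 𝓘(ℝ, E)) p (liftCurve E x t)).2 =
      deriv (extChartAt 𝓘(ℝ, E) p ∘ x) t := by
  rw [trivializationAt_snd_eq_mfderiv p _ (by exact ht)]
  exact mfderiv_extChartAt_comp_apply_one hx ht

/-- In the chart centred at the base point the coordinate change of the fibre is the identity, so
the raw fibre component is already the coordinate derivative. -/
theorem snd_liftCurve {x : ℝ → M} {t : ℝ} (hx : MDifferentiableAt 𝓘(ℝ, ℝ) 𝓘(ℝ, E) x t) :
    (liftCurve E x t).snd = deriv (extChartAt 𝓘(ℝ, E) (x t) ∘ x) t := by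
  have : IsManifold 𝓘(ℝ, E) 1 M := IsManifold.of_le (n := ∞) (by simp)
  rw [← trivializationAt_liftCurve hx (mem_chart_source E (x t))]
  rw [TangentBundle.trivializationAt_apply]
  simp only [liftCurve]
  exact (tangentCoordChange_self (I := 𝓘(ℝ, E)) (x := x t) (z := x t) (by simp)).symm

omit [IsManifold 𝓘(ℝ, E) ∞ M] in
theorem liftCurve_comp {M' : Type*} [TopologicalSpace M'] [ChartedSpace E M']
    {f : M → M'} {x : ℝ → M} {t : ℝ}
    (hf : MDifferentiableAt 𝓘(ℝ, E) 𝓘(ℝ, E) f (x t))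
    (hx : MDifferentiableAt 𝓘(ℝ, ℝ) 𝓘(ℝ, E) x t) :
    liftCurve E (f ∘ x) t = tangentMap 𝓘(ℝ, E) 𝓘(ℝ, E) f (liftCurve E x t) := by
  simp only [liftCurve, tangentMap, mfderiv_comp t hf hx]
  rfl

/-- In the chart of `TM` induced by a chart of `M`, a tangent vector field along a curve
has the base point and the fibre coordinate as components. -/
theorem extChartAt_tangent_apply (q z : TangentBundle 𝓘(ℝ, E) M) :
    extChartAt 𝓘(ℝ, E).tangent q z =
      (extChartAt 𝓘(ℝ, E) q.proj z.proj,
        (trivializationAt E (TangentSpace 𝓘(ℝ, E)) q.proj z).2) := by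
  rw [FiberBundle.extChartAt]
  simp [TangentBundle.trivializationAt_apply]

theorem mfderiv_curve_tangentBundle {ξ : ℝ → TangentBundle 𝓘(ℝ, E) M} {t : ℝ}
    (hξ : ContMDiffAt 𝓘(ℝ, ℝ) 𝓘(ℝ, E).tangent 1 ξ t) :
    mfderiv 𝓘(ℝ, ℝ) 𝓘(ℝ, E).tangent ξ t (1 : ℝ) =
      ((deriv (fun s => extChartAt 𝓘(ℝ, E) (ξ t).proj (ξ s).proj) t,
        deriv (fun s => (trivializationAt E (TangentSpace 𝓘(ℝ, E)) (ξ t).proj (ξ s)).2) t) :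
          E × E) := by
  have h := hξ.mdifferentiableAt one_ne_zero
  have hr : range 𝓘(ℝ, ℝ) = univ := by simp
  have he : writtenInExtChartAt 𝓘(ℝ, ℝ) 𝓘(ℝ, E).tangent t ξ = fun s =>
      ((extChartAt 𝓘(ℝ, E) (ξ t).proj (ξ s).proj,
        (trivializationAt E (TangentSpace 𝓘(ℝ, E)) (ξ t).proj (ξ s)).2) : E × E) := by
    ext s : 1
    exact extChartAt_tangent_apply (ξ t) (ξ s)
  have hw : DifferentiableAt ℝ (fun s => ((extChartAt 𝓘(ℝ, E) (ξ t).proj (ξ s).proj,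
        (trivializationAt E (TangentSpace 𝓘(ℝ, E)) (ξ t).proj (ξ s)).2) : E × E)) t := by
    have hw := h.differentiableWithinAt_writtenInExtChartAt
    rw [he, hr, differentiableWithinAt_univ] at hw
    exact hw
  rw [h.mfderiv, he]
  rw [hr, fderivWithin_univ]
  exact (hw.fst.hasDerivAt.prodMk hw.snd.hasDerivAt).deriv

/-- The velocity of a `C²` family of curves is a `C¹` function of the parameter,
and its derivative is given by the first and mixed second derivatives in a chart. -/
theorem liftCurve_affine_slice {G : Type*} [NormedAddCommGroup G] [NormedSpace ℝ G]
    {ψ : G → M} {a b : G} {e : ℝ → ℝ → G}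
    (he : ∀ t σ, e t σ = t • a + σ • b) {t₀ σ₀ : ℝ}
    (hψ : ContMDiffAt 𝓘(ℝ, G) 𝓘(ℝ, E) 2 ψ (e t₀ σ₀)) :
    (liftCurve E (fun t => ψ (e t σ₀)) t₀).snd =
      fderiv ℝ (extChartAt 𝓘(ℝ, E) (ψ (e t₀ σ₀)) ∘ ψ) (e t₀ σ₀) a ∧
    ContMDiffAt 𝓘(ℝ, ℝ) 𝓘(ℝ, E).tangent 1
      (fun σ => liftCurve E (fun t => ψ (e t σ)) t₀) σ₀ ∧
    mfderiv 𝓘(ℝ, ℝ) 𝓘(ℝ, E).tangent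
      (fun σ => liftCurve E (fun t => ψ (e t σ)) t₀) σ₀ (1 : ℝ) =
      ((fderiv ℝ (extChartAt 𝓘(ℝ, E) (ψ (e t₀ σ₀)) ∘ ψ) (e t₀ σ₀) b,
        fderiv ℝ (fderiv ℝ (extChartAt 𝓘(ℝ, E) (ψ (e t₀ σ₀)) ∘ ψ))
          (e t₀ σ₀) b a) : E × E) := by
  obtain rfl : e = fun t σ : ℝ => t • a + σ • b := by ext t σ; exact he t σ
  beta_reduce at hψ ⊢
  have : IsManifold 𝓘(ℝ, E) 2 M := IsManifold.of_le (n := ∞) (by norm_cast)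
  have : IsManifold 𝓘(ℝ, E) 1 M := IsManifold.of_le (n := ∞) (by simp)
  set p := ψ (t₀ • a + σ₀ • b) with hp
  set f : G → E := extChartAt 𝓘(ℝ, E) p ∘ ψ with hf
  have hcurve : ∀ σ : ℝ, HasDerivAt (fun t : ℝ => t • a + σ • b) a t₀ := fun σ =>
    (((hasDerivAt_id (𝕜 := ℝ) t₀).smul_const a).add_const (σ • b)).congr_deriv (one_smul ℝ a)
  have hcurve' : HasDerivAt (fun σ : ℝ => t₀ • a + σ • b) b σ₀ :=
    (((hasDerivAt_id σ₀).smul_const b).const_add (t₀ • a)).congr_deriv (one_smul ℝ b)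
  have hsmooth : ∀ n, ContDiff ℝ n (fun σ : ℝ => t₀ • a + σ • b) := fun n =>
    contDiff_const.add (contDiff_id.smul contDiff_const)
  have hsmooth' : ∀ n (σ : ℝ), ContDiff ℝ n (fun t : ℝ => t • a + σ • b) := fun n σ =>
    (contDiff_id.smul contDiff_const).add contDiff_const
  have hcont : Tendsto (fun σ : ℝ => t₀ • a + σ • b) (𝓝 σ₀) (𝓝 (t₀ • a + σ₀ • b)) :=
    (hsmooth 0).continuous.tendsto σ₀
  have hfC : ContDiffAt ℝ 2 f (t₀ • a + σ₀ • b) :=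
    (ContMDiffAt.comp _ (contMDiffAt_extChartAt' (mem_chart_source E p)) hψ).contDiffAt
  have hf'C : ContDiffAt ℝ 1 (fderiv ℝ f) (t₀ • a + σ₀ • b) := hfC.fderiv_right (by norm_num)
  have hslice : ∀ σ : ℝ, ContMDiffAt 𝓘(ℝ, G) 𝓘(ℝ, E) 2 ψ (t₀ • a + σ • b) →
      MDifferentiableAt 𝓘(ℝ, ℝ) 𝓘(ℝ, E) (fun t => ψ (t • a + σ • b)) t₀ := fun σ hσ =>
    (ContMDiffAt.comp (I' := 𝓘(ℝ, G)) (n := 2) t₀ (g := ψ)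
        (f := fun t : ℝ => t • a + σ • b) hσ
        (hsmooth' 2 σ).contMDiff.contMDiffAt).mdifferentiableAt (by norm_num)
  have hev : ∀ᶠ σ in 𝓝 σ₀, (trivializationAt E (TangentSpace 𝓘(ℝ, E)) p
      -- The chart is frozen at `p` while `σ` varies. For `σ` near `σ₀` the base point stays in its
      -- domain, so the fibre coordinate of the velocity is a partial derivative of `f`.
      (liftCurve E (fun t => ψ (t • a + σ • b)) t₀)).2 = fderiv ℝ f (t₀ • a + σ • b) a := by
    have h1 := hcont.eventually
      ((contMDiffAt_iff_contMDiffAt_nhds (n := 2) (by norm_num)).1 hψ)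
    have h2 := hcont.eventually
      (hψ.continuousAt.eventually_mem (chart_source_mem_nhds E p))
    filter_upwards [h1, h2] with σ hσ hσ'
    rw [trivializationAt_liftCurve (hslice σ hσ) hσ']
    have hd : DifferentiableAt ℝ f (t₀ • a + σ • b) :=
      ((ContMDiffAt.comp _ (contMDiffAt_extChartAt' hσ') hσ).contDiffAt).differentiableAt
        (n := 2) (by norm_num)
    exact (hd.hasFDerivAt.comp_hasDerivAt t₀ (hcurve σ)).deriv
  have hsm : ContDiffAt ℝ 1 (fun σ : ℝ => fderiv ℝ f (t₀ • a + σ • b) a) σ₀ :=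
    (ContDiffAt.comp σ₀ hf'C (hsmooth 1).contDiffAt).clm_apply contDiffAt_const
  have hsl : ContMDiffAt 𝓘(ℝ, ℝ) 𝓘(ℝ, E) 1 (fun σ : ℝ => ψ (t₀ • a + σ • b)) σ₀ :=
    ContMDiffAt.comp (I' := 𝓘(ℝ, G)) σ₀ (g := ψ)
      (f := fun σ : ℝ => t₀ • a + σ • b) (hψ.of_le (by norm_num))
      (hsmooth 1).contMDiff.contMDiffAt
  have hC : ContMDiffAt 𝓘(ℝ, ℝ) 𝓘(ℝ, E).tangent 1
      (fun σ => liftCurve E (fun t => ψ (t • a + σ • b)) t₀) σ₀ :=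
    Bundle.contMDiffAt_totalSpace.2 ⟨hsl, (hsm.congr_of_eventuallyEq hev).contMDiffAt⟩
  refine ⟨?_, hC, ?_⟩
  · rw [snd_liftCurve (hslice σ₀ hψ)]
    exact ((hfC.differentiableAt (by norm_num)).hasFDerivAt.comp_hasDerivAt t₀
      (hcurve σ₀)).deriv
  rw [mfderiv_curve_tangentBundle hC]
  refine Prod.ext ?_ ?_
  · exact ((hfC.differentiableAt (by norm_num)).hasFDerivAt.comp_hasDerivAt σ₀ hcurve').deriv
  · refine (Filter.EventuallyEq.deriv_eq hev).trans ?_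
    have := (hf'C.differentiableAt (by norm_num)).hasFDerivAt.comp_hasDerivAt σ₀ hcurve'
    exact (this.clm_apply (hasDerivAt_const σ₀ a)).deriv.trans (by simp)

/-- Differentiating the velocity of a `C²` family of curves with respect to the parameter gives,
by symmetry of second derivatives, the variation field and its velocity. -/
theorem mfderiv_liftCurve_slice {ψ : ℝ × ℝ → M} {t₀ σ₀ : ℝ}
    (hψ : ContMDiffAt 𝓘(ℝ, ℝ × ℝ) 𝓘(ℝ, E) 2 ψ (t₀, σ₀)) :
    ContMDiffAt 𝓘(ℝ, ℝ) 𝓘(ℝ, E).tangent 1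
      (fun σ => liftCurve E (fun t => ψ (t, σ)) t₀) σ₀ ∧
    ContMDiffAt 𝓘(ℝ, ℝ) 𝓘(ℝ, E).tangent 1
      (fun t => liftCurve E (fun σ => ψ (t, σ)) σ₀) t₀ ∧
    mfderiv 𝓘(ℝ, ℝ) 𝓘(ℝ, E).tangent
      (fun σ => liftCurve E (fun t => ψ (t, σ)) t₀) σ₀ (1 : ℝ) =
      (((liftCurve E (fun σ => ψ (t₀, σ)) σ₀).snd,
        Prod.snd (α := E) (β := E) (mfderiv 𝓘(ℝ, ℝ) 𝓘(ℝ, E).tangent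
          (fun t => liftCurve E (fun σ => ψ (t, σ)) σ₀) t₀ (1 : ℝ))) : E × E) := by
  have : IsManifold 𝓘(ℝ, E) 2 M := IsManifold.of_le (n := ∞) (by norm_cast)
  -- One lemma is used twice, with time and parameter exchanged. The two second derivatives obtained
  -- differ only in the order of their arguments.
  obtain ⟨-, h1, h1'⟩ := liftCurve_affine_slice (ψ := ψ) (a := ((1 : ℝ), (0 : ℝ)))
    (b := ((0 : ℝ), (1 : ℝ))) (e := fun t σ => (t, σ)) (by simp) (t₀ := t₀) (σ₀ := σ₀) hψ
  obtain ⟨h2, h3, h2'⟩ := liftCurve_affine_slice (ψ := ψ) (a := ((0 : ℝ), (1 : ℝ)))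
    (b := ((1 : ℝ), (0 : ℝ))) (e := fun σ t => (t, σ)) (by simp) (t₀ := σ₀) (σ₀ := t₀) hψ
  have hfC : ContDiffAt ℝ 2 (extChartAt 𝓘(ℝ, E) (ψ (t₀, σ₀)) ∘ ψ) (t₀, σ₀) :=
    (ContMDiffAt.comp (t₀, σ₀) (contMDiffAt_extChartAt' (mem_chart_source E _)) hψ).contDiffAt
  refine ⟨h1, h3, h1'.trans (Prod.ext h2.symm ?_)⟩
  exact ((hfC.isSymmSndFDerivAt (by simp)) _ _).trans (congrArg Prod.snd h2').symm

end Lift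

/-! ### From families of solutions to the displacement system -/

section Variation

variable {E : Type*} [NormedAddCommGroup E] [NormedSpace ℝ E]
  {M : Type*} [TopologicalSpace M] [ChartedSpace E M] [IsManifold 𝓘(ℝ, E) ∞ M]
  {E₁ : Type*} [NormedAddCommGroup E₁] [NormedSpace ℝ E₁]
  {U : Type*} [TopologicalSpace U] [ChartedSpace E₁ U] [IsManifold 𝓘(ℝ, E₁) ∞ U]
  {E₂ : Type*} [NormedAddCommGroup E₂] [NormedSpace ℝ E₂]
  {Y : Type*} [TopologicalSpace Y] [ChartedSpace E₂ Y] [IsManifold 𝓘(ℝ, E₂) ∞ Y]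
  {m : ℕ} {F : TangentBundle 𝓘(ℝ, E) M × (U × Y) → EuclideanSpace ℝ (Fin m)} {J : Set ℝ}

/-- A family of solutions with a common input induces, by differentiation with respect to the
parameter, an element of the displacement system with vanishing input displacement. -/
theorem inDisplacement_of_family
    (hF : ContMDiff (𝓘(ℝ, E).tangent.prod (𝓘(ℝ, E₁).prod 𝓘(ℝ, E₂)))
      𝓘(ℝ, EuclideanSpace ℝ (Fin m)) 1 F)
    {ψ : ℝ × ℝ → M} {u : ℝ → U} {ζ : ℝ × ℝ → Y} {σ₀ : ℝ}
    (hψ : ∀ t, ContMDiffAt 𝓘(ℝ, ℝ × ℝ) 𝓘(ℝ, E) 2 ψ (t, σ₀))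
    (hζ : ∀ t, ContMDiffAt 𝓘(ℝ, ℝ × ℝ) 𝓘(ℝ, E₂) 2 ζ (t, σ₀))
    (hsol : ∀ σ, InBehavior E₁ E₂ F J (fun t => ψ (t, σ)) u (fun t => ζ (t, σ))) :
    InDisplacement F J (fun t => liftCurve E (fun σ => ψ (t, σ)) σ₀)
      (fun t => (⟨u t, 0⟩ : TangentBundle 𝓘(ℝ, E₁) U))
      (fun t => liftCurve E₂ (fun σ => ζ (t, σ)) σ₀) where
  base := hsol σ₀
  state t := (mfderiv_liftCurve_slice (hψ t)).2.1
  input := by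
    have : IsManifold 𝓘(ℝ, E₁) (1 + 1) U := IsManifold.of_le (n := ∞) (by norm_cast)
    exact (Bundle.contMDiff_zeroSection ℝ (TangentSpace 𝓘(ℝ, E₁) (M := U))).comp
      ((hsol σ₀).input.of_le (by norm_num))
  output t := (mfderiv_liftCurve_slice (hζ t)).2.1
  equation t ht := by
    have hA := ((mfderiv_liftCurve_slice (hψ t)).1.mdifferentiableAt one_ne_zero).hasMFDerivAt
    have hY : MDifferentiableAt 𝓘(ℝ, ℝ) 𝓘(ℝ, E₂) (fun σ => ζ (t, σ)) σ₀ :=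
      (ContMDiffAt.comp (I' := 𝓘(ℝ, ℝ × ℝ)) σ₀ (g := ζ) (n := 2)
        (f := fun σ => (t, σ)) (hζ t)
        (contDiff_const.prodMk contDiff_id).contMDiff.contMDiffAt).mdifferentiableAt (by norm_num)
    have hU := hasMFDerivAt_const (I := 𝓘(ℝ, ℝ)) (I' := 𝓘(ℝ, E₁)) (u t) σ₀
    have hP := hA.prodMk (hU.prodMk hY.hasMFDerivAt)
    have hFP := (((hF.contMDiffAt).mdifferentiableAt one_ne_zero).hasMFDerivAt).comp σ₀ hP
    -- For fixed `t` the equation holds for every `σ`, so its `σ`-derivative vanishes. By the chain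
    -- rule this derivative is the displacement equation, once the derivative of the lifted velocity
    -- is rewritten as `(δx, δẋ)`.
    have h0 : (F ∘ fun σ => (liftCurve E (fun t => ψ (t, σ)) t, (u t, ζ (t, σ)))) =
        fun _ => 0 := funext fun σ => (hsol σ).equation t ht
    rw [h0] at hFP
    have hz := hasMFDerivAt_unique hFP (hasMFDerivAt_const 0 σ₀)
    have hz1 := DFunLike.congr_fun hz (1 : ℝ)
    refine Eq.trans ?_ hz1
    let D : (E × E) × (E₁ × E₂) → EuclideanSpace ℝ (Fin m) :=
      mfderiv (𝓘(ℝ, E).tangent.prod (𝓘(ℝ, E₁).prod 𝓘(ℝ, E₂))) 𝓘(ℝ, EuclideanSpace ℝ (Fin m)) F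
        (liftCurve E (fun t => ψ (t, σ₀)) t, (u t, ζ (t, σ₀)))
    exact congrArg (fun z : E × E => D (z, ((0 : E₁), (liftCurve E₂ (fun σ => ζ (t, σ)) σ₀).snd)))
      (mfderiv_liftCurve_slice (hψ t)).2.2.symm

omit [IsManifold 𝓘(ℝ, E) ∞ M] in
theorem liftCurve_congr {x x' : ℝ → M} {t : ℝ} (h : x =ᶠ[𝓝 t] x') :
    liftCurve E x t = liftCurve E x' t := by
  refine Bundle.TotalSpace.ext h.eq_of_nhds (heq_of_eq ?_)
  exact DFunLike.congr_fun (h.mfderiv_eq (I := 𝓘(ℝ, ℝ)) (I' := 𝓘(ℝ, E))) (1 : ℝ)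

/-- Every tangent vector is the velocity at time `0` of a curve that is `C²` near `0`. -/
theorem exists_liftCurve_eq (z : TangentBundle 𝓘(ℝ, E) M) :
    ∃ c : ℝ → M, ContMDiffAt 𝓘(ℝ, ℝ) 𝓘(ℝ, E) 2 c 0 ∧ liftCurve E c 0 = z := by
  have : IsManifold 𝓘(ℝ, E) 2 M := IsManifold.of_le (n := ∞) (by norm_cast)
  have : IsManifold 𝓘(ℝ, E) 1 M := IsManifold.of_le (n := ∞) (by simp)
  obtain ⟨p, v⟩ := z
  let e := extChartAt 𝓘(ℝ, E) p
  -- Over its own base point a tangent vector coincides with its chart coordinates, so `v` serves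
  -- directly as the direction of a line in the chart.
  let w : E := v
  let l : ℝ → E := fun σ => e p + σ • w
  have hl0 : l 0 = e p := by simp [l]
  have hl : ContDiff ℝ 2 l := contDiff_const.add (contDiff_id.smul contDiff_const)
  have hld : HasDerivAt l w 0 :=
    (((hasDerivAt_id (0 : ℝ)).smul_const w).const_add (e p)).congr_deriv (one_smul ℝ w)
  have hc0 : (e.symm ∘ l) 0 = p := by simp [hl0, e]
  have hc : ContMDiffAt 𝓘(ℝ, ℝ) 𝓘(ℝ, E) 2 (e.symm ∘ l) 0 := by
    refine ContMDiffAt.comp (I' := 𝓘(ℝ, E)) 0 ?_ hl.contMDiff.contMDiffAt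
    rw [hl0]
    exact (contMDiffOn_extChartAt_symm p).contMDiffAt (extChartAt_target_mem_nhds p)
  refine ⟨e.symm ∘ l, hc, ?_⟩
  have hs := snd_liftCurve (hc.mdifferentiableAt (by norm_num))
  have hd : deriv (extChartAt 𝓘(ℝ, E) ((e.symm ∘ l) 0) ∘ (e.symm ∘ l)) 0 = w := by
    rw [hc0]
    have he : (e ∘ (e.symm ∘ l)) =ᶠ[𝓝 0] l := by
      have : ∀ᶠ σ in 𝓝 0, l σ ∈ e.target := by
        refine hl.continuous.continuousAt.eventually_mem ?_
        rw [hl0]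
        exact extChartAt_target_mem_nhds p
      filter_upwards [this] with σ hσ using e.right_inv hσ
    rw [he.deriv_eq, hld.deriv]
  rw [hd] at hs
  refine Bundle.TotalSpace.ext hc0 (heq_of_eq hs)

variable {Q : M → TangentBundle 𝓘(ℝ, E₁) U → TangentBundle 𝓘(ℝ, E₂) Y → ℝ}
  {S : TangentBundle 𝓘(ℝ, E) M → ℝ}

/-- Along the flow of a system with a fixed input, a differential storage function whose supply
rate vanishes at zero input displacement does not increase. -/
theorem storage_tangentMap_le
    (hF : ContMDiff (𝓘(ℝ, E).tangent.prod (𝓘(ℝ, E₁).prod 𝓘(ℝ, E₂)))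
      𝓘(ℝ, EuclideanSpace ℝ (Fin m)) 1 F)
    (hdiss : IsDissipationInequality F J S Q)
    (hQ0 : ∀ (x : M) (u : U) (ν : TangentBundle 𝓘(ℝ, E₂) Y), Q x ⟨u, 0⟩ ν = 0)
    {φ : ℝ × M → M} {η : ℝ × M → Y} {u : ℝ → U}
    (hφ : ContMDiff (𝓘(ℝ, ℝ).prod 𝓘(ℝ, E)) 𝓘(ℝ, E) 2 φ)
    (hη : ContMDiff (𝓘(ℝ, ℝ).prod 𝓘(ℝ, E)) 𝓘(ℝ, E₂) 2 η)
    (hsol : ∀ x₀ : M, φ (0, x₀) = x₀ ∧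
        InBehavior E₁ E₂ F J (fun t => φ (t, x₀)) u (fun t => η (t, x₀)))
    (z : TangentBundle 𝓘(ℝ, E) M) {t : ℝ} (ht : 0 ≤ t) :
    S (tangentMap 𝓘(ℝ, E) 𝓘(ℝ, E) (fun x => φ (t, x)) z) ≤ S z := by
  obtain ⟨c, hc, rfl⟩ := exists_liftCurve_eq z
  -- The curve `c` is known to be `C²` only near `0`, so smoothness of the family is available only
  -- at `σ = 0`; the solution property holds for every `σ`.
  have hpair : ∀ t, ContMDiffAt 𝓘(ℝ, ℝ × ℝ) (𝓘(ℝ, ℝ).prod 𝓘(ℝ, E)) 2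
      (fun q : ℝ × ℝ => (q.1, c q.2)) (t, 0) := fun t =>
    contDiff_fst.contMDiff.contMDiffAt.prodMk
      (ContMDiffAt.comp (I' := 𝓘(ℝ, ℝ)) (t, 0) (g := c) (f := Prod.snd) hc
        contDiff_snd.contMDiff.contMDiffAt)
  have hdis := inDisplacement_of_family hF (ψ := fun q => φ (q.1, c q.2))
    (ζ := fun q => η (q.1, c q.2)) (σ₀ := 0)
    (fun t => hφ.contMDiffAt.comp (t, 0) (hpair t)) (fun t => hη.contMDiffAt.comp (t, 0) (hpair t))
    (fun σ => (hsol (c σ)).2)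
  have h := hdiss _ _ _ hdis t ht
  simp only [hQ0, intervalIntegral.integral_zero, sub_nonpos, (hsol _).1] at h
  rw [← liftCurve_comp]
  · exact h
  · refine MDifferentiableAt.comp (I' := 𝓘(ℝ, ℝ).prod 𝓘(ℝ, E)) _ (g := φ)
      (hφ.contMDiffAt.mdifferentiableAt (by norm_num)) ?_
    exact (contMDiffAt_const.prodMk contMDiffAt_id).mdifferentiableAt one_ne_zero
  · exact hc.mdifferentiableAt (by norm_num)

end Variation

/-! ### Piecewise smooth curves, their lengths and the induced distance -/

section PiecewiseCurves

variable {E : Type*} [NormedAddCommGroup E] [NormedSpace ℝ E]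
  {M : Type*} [TopologicalSpace M] [ChartedSpace E M]

theorem IsPiecewiseC1.continuousOn {γ : ℝ → M} (hγ : IsPiecewiseC1 E γ) :
    ContinuousOn γ (Icc 0 1) := by
  obtain ⟨n, τ, hτ, h0, h1, h⟩ := hγ
  have key : ∀ k ≤ n, ContinuousOn γ (Icc (τ 0) (τ k)) := by
    intro k
    induction k with
    | zero => simp
    | succ k ih =>
      intro hk
      rw [← Icc_union_Icc_eq_Icc (hτ (Nat.zero_le k)) (hτ (Nat.le_succ k))]
      exact (ih (by omega)).union_of_isClosed (h k (by omega)).continuousOn isClosed_Icc isClosed_Icc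
  simpa [h0, h1] using key n le_rfl

/-- The excluded breakpoints contain `0` and `1`, where the two-sided derivative would depend on
values of the curve outside `[0,1]`. -/
theorem IsPiecewiseC1.exists_countable {γ : ℝ → M} (hγ : IsPiecewiseC1 E γ) :
    ∃ s : Set ℝ, s.Countable ∧ ∀ t ∈ Icc (0 : ℝ) 1, t ∉ s →
      ContMDiffAt 𝓘(ℝ, ℝ) 𝓘(ℝ, E) 1 γ t := by
  obtain ⟨n, τ, hτ, h0, h1, h⟩ := hγ
  refine ⟨range τ, countable_range τ, fun t ht hts => ?_⟩
  have key : ∀ k ≤ n, t ≤ τ k → ContMDiffAt 𝓘(ℝ, ℝ) 𝓘(ℝ, E) 1 γ t := by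
    intro k
    induction k with
    | zero =>
      intro _ hk
      exact absurd ⟨0, le_antisymm (h0.trans_le ht.1) hk⟩ hts
    | succ k ih =>
      intro hk htk
      rcases le_or_gt t (τ k) with h' | h'
      · exact ih (by omega) h'
      · have : t < τ (k + 1) := lt_of_le_of_ne htk fun e => hts ⟨_, e.symm⟩
        exact (h k (by omega)).contMDiffAt (Icc_mem_nhds h' this)
  exact key n le_rfl (ht.2.trans_eq h1.symm)

theorem IsPiecewiseC1.ae_contMDiffAt {γ : ℝ → M} (hγ : IsPiecewiseC1 E γ) :
    ∀ᵐ s ∂volume.restrict (Icc (0 : ℝ) 1), ContMDiffAt 𝓘(ℝ, ℝ) 𝓘(ℝ, E) 1 γ s := by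
  obtain ⟨s, hs, h⟩ := hγ.exists_countable
  rw [ae_restrict_iff' measurableSet_Icc]
  filter_upwards [hs.ae_notMem volume] with t ht ht' using h t ht' ht

theorem ContMDiffOn.isPiecewiseC1 {γ : ℝ → M}
    (hγ : ContMDiffOn 𝓘(ℝ, ℝ) 𝓘(ℝ, E) 1 γ (Icc 0 1)) : IsPiecewiseC1 E γ :=
  ⟨1, fun i => i, Nat.mono_cast, by simp, by simp, fun i hi => by
    obtain rfl : i = 0 := by omega
    simpa using hγ⟩

theorem IsPiecewiseC1.comp {f : M → M} (hf : ContMDiff 𝓘(ℝ, E) 𝓘(ℝ, E) 1 f) {γ : ℝ → M}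
    (hγ : IsPiecewiseC1 E γ) : IsPiecewiseC1 E (f ∘ γ) := by
  obtain ⟨n, τ, hτ, h0, h1, h⟩ := hγ
  exact ⟨n, τ, hτ, h0, h1, fun i hi => hf.comp_contMDiffOn (h i hi)⟩

/-- The concatenation of two curves, each run through with double speed. -/
def concat (γ₁ γ₂ : ℝ → M) (s : ℝ) : M :=
  if s ≤ 1 / 2 then γ₁ (2 * s) else γ₂ (2 * s - 1)

omit [TopologicalSpace M] in
theorem concat_of_le {γ₁ γ₂ : ℝ → M} {s : ℝ} (hs : s ≤ 1 / 2) :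
    concat γ₁ γ₂ s = γ₁ (2 * s) := if_pos hs

omit [TopologicalSpace M] in
theorem concat_of_ge {γ₁ γ₂ : ℝ → M} (h : γ₁ 1 = γ₂ 0) {s : ℝ} (hs : 1 / 2 ≤ s) :
    concat γ₁ γ₂ s = γ₂ (2 * s - 1) := by
  rcases hs.eq_or_lt with rfl | hs
  · rw [concat_of_le le_rfl]
    norm_num [h]
  · exact if_neg hs.not_ge

theorem IsPiecewiseC1.concat {γ₁ γ₂ : ℝ → M} (h₁ : IsPiecewiseC1 E γ₁) (h₂ : IsPiecewiseC1 E γ₂)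
    (h : γ₁ 1 = γ₂ 0) : IsPiecewiseC1 E (concat γ₁ γ₂) := by
  obtain ⟨n, τ, hτ, hτ0, hτ1, hγ₁⟩ := h₁
  obtain ⟨k, σ, hσ, hσ0, hσ1, hγ₂⟩ := h₂
  -- The subdivisions of the two curves are compressed into `[0,1/2]` and `[1/2,1]`. At index `n`
  -- both formulas give `1/2`.
  let ρ : ℕ → ℝ := fun i => if i ≤ n then τ i / 2 else (σ (i - n) + 1) / 2
  have hρ1 : ∀ i ≤ n, ρ i = τ i / 2 := fun i hi => if_pos hi
  have hρ2 : ∀ i, ρ (n + i) = (σ i + 1) / 2 := fun i => by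
    rcases Nat.eq_zero_or_pos i with rfl | hi
    · simp [ρ, hτ1, hσ0]
    · simp [ρ, hi.ne']
  refine ⟨n + k, ρ, monotone_nat_of_le_succ fun i => ?_, ?_, ?_, fun i hi => ?_⟩
  · rcases lt_or_ge i n with hi | hi
    · rw [hρ1 i hi.le, hρ1 (i + 1) hi]
      have := hτ (Nat.le_succ i)
      linarith
    · obtain ⟨j, rfl⟩ := Nat.exists_eq_add_of_le hi
      rw [hρ2, add_assoc, hρ2]
      have := hσ (Nat.le_succ j)
      linarith
  · rw [hρ1 0 (Nat.zero_le n), hτ0, zero_div]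
  · rw [hρ2, hσ1]
    norm_num
  · rcases lt_or_ge i n with hi | hi
    · rw [hρ1 i hi.le, hρ1 (i + 1) hi]
      have hle : τ (i + 1) ≤ 1 := hτ1 ▸ hτ hi
      have hmap : MapsTo (fun s : ℝ => 2 * s) (Icc (τ i / 2) (τ (i + 1) / 2))
          (Icc (τ i) (τ (i + 1))) := fun s hs => ⟨by linarith [hs.1], by linarith [hs.2]⟩
      refine ((hγ₁ i hi).comp (contDiff_const.mul contDiff_id).contMDiff.contMDiffOn hmap).congr
        fun s hs => concat_of_le (by linarith [hs.2])
    · obtain ⟨j, rfl⟩ := Nat.exists_eq_add_of_le hi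
      rw [hρ2, add_assoc, hρ2]
      have hle : 0 ≤ σ j := hσ0 ▸ hσ (Nat.zero_le j)
      have hmap : MapsTo (fun s : ℝ => 2 * s - 1) (Icc ((σ j + 1) / 2) ((σ (j + 1) + 1) / 2))
          (Icc (σ j) (σ (j + 1))) := fun s hs => ⟨by linarith [hs.1], by linarith [hs.2]⟩
      refine ((hγ₂ j (by omega)).comp
        ((contDiff_const.mul contDiff_id).sub contDiff_const).contMDiff.contMDiffOn hmap).congr
        fun s hs => concat_of_ge h (by linarith [hs.1])

/-- No differentiability is needed: an invertible affine substitution preserves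
non-differentiability, and then both derivatives take the default value zero. -/
theorem liftCurve_comp_affine (γ : ℝ → M) {a : ℝ} (ha : a ≠ 0) (b s : ℝ) :
    liftCurve E (fun s => γ (a * s + b)) s =
      ⟨γ (a * s + b), a • (liftCurve E γ (a * s + b)).snd⟩ := by
  have hl : ∀ a b s : ℝ, HasDerivAt (fun s : ℝ => a * s + b) a s := fun a b s => by
    simpa using ((hasDerivAt_id s).const_mul a).add_const b
  have hd : ∀ a b s : ℝ, MDifferentiableAt 𝓘(ℝ, ℝ) 𝓘(ℝ, ℝ) (fun s : ℝ => a * s + b) s :=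
    fun a b s => (hl a b s).differentiableAt.mdifferentiableAt
  refine Bundle.TotalSpace.ext rfl (heq_of_eq ?_)
  by_cases hγ : MDifferentiableAt 𝓘(ℝ, ℝ) 𝓘(ℝ, E) γ (a * s + b)
  · have h := mfderiv_comp (I' := 𝓘(ℝ, ℝ)) s (g := γ) (f := fun s : ℝ => a * s + b) hγ (hd a b s)
    have h1 : mfderiv 𝓘(ℝ, ℝ) 𝓘(ℝ, ℝ) (fun s : ℝ => a * s + b) s (1 : ℝ) = a := by
      rw [mfderiv_eq_fderiv]
      exact (hl a b s).deriv
    let D : ℝ →L[ℝ] E := mfderiv 𝓘(ℝ, ℝ) 𝓘(ℝ, E) γ (a * s + b)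
    have hD : D a = a • D 1 := by rw [← map_smul, smul_eq_mul, mul_one]
    exact (DFunLike.congr_fun h (1 : ℝ)).trans ((congrArg D h1).trans hD)
  · have hγ' : ¬ MDifferentiableAt 𝓘(ℝ, ℝ) 𝓘(ℝ, E) (fun s => γ (a * s + b)) s := by
      refine fun hc => hγ ?_
      have e : s = a⁻¹ * (a * s + b) + (-(a⁻¹ * b)) := by field_simp; ring
      have := MDifferentiableAt.comp (I' := 𝓘(ℝ, ℝ)) (a * s + b)
        (g := fun s => γ (a * s + b)) (f := fun r => a⁻¹ * r + (-(a⁻¹ * b))) (e ▸ hc)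
        (hd _ _ _)
      convert this using 1
      ext r
      simp only [Function.comp]
      congr 1
      field_simp
      ring
    have h1 := DFunLike.congr_fun (mfderiv_zero_of_not_mdifferentiableAt hγ') (1 : ℝ)
    have h2 := DFunLike.congr_fun (mfderiv_zero_of_not_mdifferentiableAt hγ) (1 : ℝ)
    exact h1.trans ((smul_zero a).symm.trans (congrArg (fun w : E => a • w) h2).symm)

/-- Positive homogeneity of degree one of a function on the tangent bundle. -/
def IsPosHomogeneous (N : TangentBundle 𝓘(ℝ, E) M → ℝ) : Prop :=
  ∀ (x : M) (v : TangentSpace 𝓘(ℝ, E) x) (l : ℝ), 0 < l → N ⟨x, l • v⟩ = l * N ⟨x, v⟩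

theorem IsPosHomogeneous.map_zero {N : TangentBundle 𝓘(ℝ, E) M → ℝ} (hN : IsPosHomogeneous N)
    (x : M) : N ⟨x, 0⟩ = 0 := by
  have := hN x 0 2 two_pos
  rw [smul_zero] at this
  linarith

/-- The factor `a` that homogeneity extracts from the velocity is exactly the Jacobian of the
substitution. -/
theorem lintegral_liftCurve_affine {N : TangentBundle 𝓘(ℝ, E) M → ℝ} (hN : IsPosHomogeneous N)
    (γ : ℝ → M) {a : ℝ} (ha : 0 < a) (b c d : ℝ) :
    ∫⁻ s in Icc c d, ENNReal.ofReal (N (liftCurve E (fun s => γ (a * s + b)) s)) =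
      ∫⁻ s in Icc (a * c + b) (a * d + b), ENNReal.ofReal (N (liftCurve E γ s)) := by
  rw [← image_affine_Icc' ha, lintegral_image_eq_lintegral_abs_deriv_mul (f' := fun _ => a)
    measurableSet_Icc]
  · refine lintegral_congr fun s => ?_
    rw [liftCurve_comp_affine γ ha.ne', abs_of_pos ha, ← ENNReal.ofReal_mul ha.le]
    exact congrArg ENNReal.ofReal (hN _ _ a ha)
  · intro x _
    simpa using (((hasDerivAt_id x).const_mul a).add_const b).hasDerivWithinAt
  · intro x _ y _ hxy
    simpa [ha.ne'] using hxy

theorem curveLength_concat_le {N : TangentBundle 𝓘(ℝ, E) M → ℝ} (hN : IsPosHomogeneous N)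
    (γ₁ γ₂ : ℝ → M) :
    curveLength N (concat γ₁ γ₂) ≤ curveLength N γ₁ + curveLength N γ₂ := by
  have hu : Icc (0 : ℝ) 1 = Icc 0 (1 / 2) ∪ Icc (1 / 2) 1 :=
    (Icc_union_Icc_eq_Icc (by norm_num) (by norm_num)).symm
  -- At `1/2` the derivative sees both halves. Away from this null set the concatenation agrees
  -- locally with one reparametrized curve.
  have hne : ∀ A : Set ℝ, ∀ᵐ s : ℝ ∂volume.restrict A, s ≠ 1 / 2 := fun A =>
    ae_restrict_of_ae ((countable_singleton (1 / 2 : ℝ)).ae_notMem volume)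
  unfold curveLength
  rw [hu]
  refine (lintegral_union_le _ _ _).trans (add_le_add (le_of_eq ?_) (le_of_eq ?_))
  · rw [← hu]
    have h := lintegral_liftCurve_affine hN γ₁ (two_pos) 0 0 (1 / 2)
    norm_num at h
    rw [← h]
    refine lintegral_congr_ae ?_
    filter_upwards [ae_restrict_mem measurableSet_Icc, hne _] with s hs hs'
    rw [liftCurve_congr (x' := fun s => γ₁ (2 * s))]
    filter_upwards [Iio_mem_nhds (lt_of_le_of_ne hs.2 hs')] with r hr using concat_of_le hr.le
  · rw [← hu]
    have h := lintegral_liftCurve_affine hN γ₂ (two_pos) (-1) (1 / 2) 1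
    norm_num at h
    rw [← h]
    refine lintegral_congr_ae ?_
    filter_upwards [ae_restrict_mem measurableSet_Icc, hne _] with s hs hs'
    rw [liftCurve_congr (x' := fun s => γ₂ (2 * s + -1))]
    filter_upwards [Ioi_mem_nhds (lt_of_le_of_ne hs.1 hs'.symm)] with r hr
    exact if_neg (not_le.2 hr)

theorem inducedDist_le_curveLength (N : TangentBundle 𝓘(ℝ, E) M → ℝ) {γ : ℝ → M}
    (hγ : IsPiecewiseC1 E γ) : inducedDist N (γ 0) (γ 1) ≤ curveLength N γ :=
  iInf₂_le γ ⟨hγ, rfl, rfl⟩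

theorem inducedDist_self {N : TangentBundle 𝓘(ℝ, E) M → ℝ} (hN : IsPosHomogeneous N) (a : M) :
    inducedDist N a a = 0 := by
  refine le_antisymm ?_ bot_le
  refine (inducedDist_le_curveLength N (γ := fun _ => a)
    (ContMDiffOn.isPiecewiseC1 contMDiffOn_const)).trans (le_of_eq ?_)
  have : ∀ s : ℝ, N (liftCurve E (fun _ => a) s) = 0 := fun s => by
    simp only [liftCurve, mfderiv_const]
    exact hN.map_zero a
  simp [curveLength, this]

theorem inducedDist_triangle {N : TangentBundle 𝓘(ℝ, E) M → ℝ} (hN : IsPosHomogeneous N)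
    (a b c : M) : inducedDist N a c ≤ inducedDist N a b + inducedDist N b c := by
  refine ENNReal.le_iInf₂_add_iInf₂ fun γ₁ h₁ γ₂ h₂ => ?_
  obtain ⟨h₁, rfl, hb⟩ := h₁
  obtain ⟨h₂, rfl, rfl⟩ := h₂
  have h := inducedDist_le_curveLength N (h₁.concat h₂ hb)
  rw [concat_of_le (by norm_num), concat_of_ge hb (by norm_num)] at h
  norm_num at h
  exact h.trans (curveLength_concat_le hN γ₁ γ₂)

/-- If the right side is infinite there is nothing to prove. Otherwise `deriv f`, which is always
measurable, is integrable, and the fundamental theorem of calculus off a countable set applies. -/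
theorem enorm_sub_le_lintegral_deriv {f : ℝ → ℝ} {s : Set ℝ} (hs : s.Countable)
    (hf : ContinuousOn f (Icc 0 1)) (hd : ∀ t ∈ Icc (0 : ℝ) 1, t ∉ s → DifferentiableAt ℝ f t) :
    ‖f 1 - f 0‖ₑ ≤ ∫⁻ t in Icc (0 : ℝ) 1, ‖deriv f t‖ₑ := by
  by_cases hfin : ∫⁻ t in Icc (0 : ℝ) 1, ‖deriv f t‖ₑ = ⊤
  · rw [hfin]
    exact le_top
  have hint : IntegrableOn (deriv f) (Icc 0 1) :=
    ⟨(measurable_deriv f).aestronglyMeasurable, lt_top_iff_ne_top.2 hfin⟩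
  rw [← integral_eq_of_hasDerivAt_off_countable_of_le f (deriv f) zero_le_one hs hf
    (fun x hx => (hd x (Ioo_subset_Icc_self hx.1) hx.2).hasDerivAt)
    ((intervalIntegrable_iff_integrableOn_Icc_of_le zero_le_one).2 hint),
    intervalIntegral.integral_of_le zero_le_one, ← integral_Icc_eq_integral_Ioc]
  exact enorm_integral_le_lintegral_enorm _

/-- A `C¹` function whose differential is bounded by a function `N` on the tangent
bundle is Lipschitz for the distance induced by `N`. -/
theorem enorm_sub_le_inducedDist {N : TangentBundle 𝓘(ℝ, E) M → ℝ} {ρ : M → ℝ}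
    (hρ : ContMDiff 𝓘(ℝ, E) 𝓘(ℝ, ℝ) 1 ρ) {C : ℝ} (hC0 : 0 < C)
    (hC : ∀ (x : M) (v : TangentSpace 𝓘(ℝ, E) x),
      abs (α := ℝ) (mfderiv 𝓘(ℝ, E) 𝓘(ℝ, ℝ) ρ x v) ≤ C * N ⟨x, v⟩) (a b : M) :
    ‖ρ b - ρ a‖ₑ ≤ ENNReal.ofReal C * inducedDist N a b := by
  unfold inducedDist
  simp only [ENNReal.mul_iInf_of_ne (ENNReal.ofReal_pos.2 hC0).ne' ENNReal.ofReal_ne_top]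
  refine le_iInf₂ fun γ => ?_
  rintro ⟨hγ, rfl, rfl⟩
  obtain ⟨s, hs, hd⟩ := hγ.exists_countable
  let D : ℝ → ℝ := fun t => mfderiv 𝓘(ℝ, E) 𝓘(ℝ, ℝ) ρ (γ t) (liftCurve E γ t).snd
  have hdiff : ∀ t, ContMDiffAt 𝓘(ℝ, ℝ) 𝓘(ℝ, E) 1 γ t → HasDerivAt (ρ ∘ γ) (D t) t := by
    intro t ht
    let L : ℝ →L[ℝ] ℝ := (mfderiv 𝓘(ℝ, E) 𝓘(ℝ, ℝ) ρ (γ t)).comp (mfderiv 𝓘(ℝ, ℝ) 𝓘(ℝ, E) γ t)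
    have h : HasFDerivAt (ρ ∘ γ) L t :=
      ((hρ.contMDiffAt.mdifferentiableAt one_ne_zero).hasMFDerivAt.comp t
        (ht.mdifferentiableAt one_ne_zero).hasMFDerivAt).hasFDerivAt
    exact h.hasDerivAt
  refine (enorm_sub_le_lintegral_deriv (f := ρ ∘ γ) hs
    (hρ.continuous.comp_continuousOn hγ.continuousOn)
    fun t ht hts => (hdiff t (hd t ht hts)).differentiableAt).trans ?_
  rw [curveLength, ← lintegral_const_mul' _ _ ENNReal.ofReal_ne_top]
  refine lintegral_mono_ae ?_
  filter_upwards [hγ.ae_contMDiffAt] with t ht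
  rw [(hdiff t ht).deriv, ← ENNReal.ofReal_mul hC0.le, Real.enorm_eq_ofReal_abs]
  exact ENNReal.ofReal_le_ofReal (hC _ _)

end PiecewiseCurves

/-- A family of positively homogeneous functions on a finite-dimensional space, continuous on the
unit sphere at the parameter `x₀` and there less than `C`, is bounded by `C` times the norm for all
parameters close to `x₀`. -/
theorem eventually_forall_lt_mul_norm {X W : Type*} [TopologicalSpace X]
    [NormedAddCommGroup W] [NormedSpace ℝ W] [FiniteDimensional ℝ W]
    {g : X → W → ℝ} {x₀ : X} {C : ℝ}
    (hom : ∀ᶠ x in 𝓝 x₀, ∀ w : W, ∀ l : ℝ, 0 < l → g x (l • w) = l * g x w)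
    (hg : ∀ w : W, ‖w‖ = 1 → ContinuousAt (fun z : X × W => g z.1 z.2) (x₀, w))
    (hC : ∀ w : W, ‖w‖ = 1 → g x₀ w < C) :
    ∀ᶠ x in 𝓝 x₀, ∀ w : W, w ≠ 0 → g x w < C * ‖w‖ := by
  -- The tube lemma on the compact unit sphere; scaling then reaches all nonzero vectors. The sign
  -- of `C` is free, so lower bounds and definiteness follow in the same way.
  have h1 : ∀ᶠ x in 𝓝 x₀, ∀ w ∈ Metric.sphere (0 : W) 1, g x w < C :=
    (isCompact_sphere (0 : W) 1).eventually_forall_of_forall_eventually fun w hw =>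
      (hg w (by simpa using hw)).eventually_lt continuousAt_const (hC w (by simpa using hw))
  filter_upwards [h1, hom] with x hx hl w hw
  have hw' : 0 < ‖w‖ := norm_pos_iff.2 hw
  have h := hx (‖w‖⁻¹ • w) (by simp [norm_smul, hw'.ne'])
  have e : w = ‖w‖ • (‖w‖⁻¹ • w) := by rw [smul_smul, mul_inv_cancel₀ hw'.ne', one_smul]
  have h' := hl (‖w‖⁻¹ • w) ‖w‖ hw'
  rw [← e] at h'
  rw [h', mul_comm]
  exact mul_lt_mul_of_pos_right h hw'

theorem exists_forall_norm_eq_one_lt {W : Type*}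
    [NormedAddCommGroup W] [NormedSpace ℝ W] [FiniteDimensional ℝ W] {g : W → ℝ}
    (hg : ∀ w : W, ‖w‖ = 1 → ContinuousAt g w) : ∃ C > 0, ∀ w : W, ‖w‖ = 1 → g w < C := by
  obtain ⟨C, hC⟩ := (isCompact_sphere (0 : W) 1).bddAbove_image (f := g)
    (fun w hw => (hg w (by simpa using hw)).continuousWithinAt)
  refine ⟨max C 0 + 1, by positivity, fun w hw => ?_⟩
  have := hC (mem_image_of_mem g (by simpa using hw : w ∈ Metric.sphere (0 : W) 1))
  exact lt_of_le_of_lt (this.trans (le_max_left _ _)) (lt_add_one _)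

/-! ### Tangent coordinates, local boundedness and finiteness of the distance -/

section

variable {E : Type*} [NormedAddCommGroup E] [NormedSpace ℝ E]
  {M : Type*} [TopologicalSpace M] [ChartedSpace E M] [IsManifold 𝓘(ℝ, E) ∞ M]

/-- The tangent vector at `x` with coordinates `w` in the trivialization over the chart at `p`. -/
def tangentMk (p x : M) (w : E) : TangentBundle 𝓘(ℝ, E) M :=
  ⟨x, (trivializationAt E (TangentSpace 𝓘(ℝ, E)) p).symmL ℝ x w⟩

theorem tangentMk_eq_symm {p x : M} (hx : x ∈ (chartAt E p).source) (w : E) :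
    tangentMk p x w = ⟨x, (trivializationAt E (TangentSpace 𝓘(ℝ, E)) p).symm x w⟩ :=
  Bundle.TotalSpace.ext rfl (heq_of_eq (Bundle.Trivialization.symmL_apply _ (by exact hx) _))

theorem continuousAt_tangentMk {p x : M} (hx : x ∈ (chartAt E p).source) (w : E) :
    ContinuousAt (fun z : M × E => tangentMk p z.1 z.2) (x, w) := by
  have h := (trivializationAt E (TangentSpace 𝓘(ℝ, E)) p).continuousOn_symm
  have hO := (chartAt E p).open_source.mem_nhds hx
  refine (h.continuousAt (prod_mem_nhds hO univ_mem)).congr ?_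
  filter_upwards [prod_mem_nhds hO univ_mem] with z hz using (tangentMk_eq_symm hz.1 z.2).symm

theorem tangentMk_trivialization {p : M} {z : TangentBundle 𝓘(ℝ, E) M}
    (hz : z.proj ∈ (chartAt E p).source) :
    tangentMk p z.proj (trivializationAt E (TangentSpace 𝓘(ℝ, E)) p z).2 = z := by
  have hz' : z.proj ∈ (trivializationAt E (TangentSpace 𝓘(ℝ, E)) p).baseSet := hz
  rw [tangentMk_eq_symm hz]
  exact Bundle.TotalSpace.ext rfl (heq_of_eq
    ((trivializationAt E (TangentSpace 𝓘(ℝ, E)) p).symm_apply_apply_mk hz' z.snd))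

theorem trivialization_tangentMk {p x : M} (hx : x ∈ (chartAt E p).source) (w : E) :
    (trivializationAt E (TangentSpace 𝓘(ℝ, E)) p (tangentMk p x w)).2 = w := by
  have hx' : x ∈ (trivializationAt E (TangentSpace 𝓘(ℝ, E)) p).baseSet := hx
  rw [tangentMk_eq_symm hx]
  exact congrArg Prod.snd
    ((trivializationAt E (TangentSpace 𝓘(ℝ, E)) p).apply_mk_symm hx' w)

/-- `symmL` is linear at every `x`, even outside the chart domain, so homogeneity in these
coordinates holds without restricting `x`. -/
theorem tangentMk_smul (p x : M) (l : ℝ) (w : E) :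
    tangentMk p x (l • w) = ⟨x, l • (trivializationAt E (TangentSpace 𝓘(ℝ, E)) p).symmL ℝ x w⟩ :=
  Bundle.TotalSpace.ext rfl (heq_of_eq
    (((trivializationAt E (TangentSpace 𝓘(ℝ, E)) p).symmL ℝ x).map_smul l w))

theorem tangentMk_snd_ne_zero {p : M} {w : E} (hw : w ≠ 0) : (tangentMk p p w).snd ≠ 0 := by
  intro h0
  have e : tangentMk p p w = tangentMk p p (0 : E) :=
    Bundle.TotalSpace.ext rfl (heq_of_eq (h0.trans
      (map_zero ((trivializationAt E (TangentSpace 𝓘(ℝ, E)) p).symmL ℝ p)).symm))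
  have e2 := trivialization_tangentMk (mem_chart_source E p) w
  rw [e, trivialization_tangentMk (mem_chart_source E p)] at e2
  exact hw e2.symm

/-- A function on the tangent bundle is locally bounded, relative to the norm of the coordinates of
tangent vectors. -/
def IsLocallyBounded (N : TangentBundle 𝓘(ℝ, E) M → ℝ) : Prop :=
  ∀ p : M, ∃ C : ℝ, ∀ᶠ x in 𝓝 p, ∀ v : TangentSpace 𝓘(ℝ, E) x,
    N ⟨x, v⟩ ≤ C * ‖(trivializationAt E (TangentSpace 𝓘(ℝ, E)) p ⟨x, v⟩).2‖

/-- For a locally bounded function `N`, chart segments have finite length, hence points near `p`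
have finite distance to and from `p`. -/
theorem eventually_inducedDist_ne_top {N : TangentBundle 𝓘(ℝ, E) M → ℝ} (hN : IsLocallyBounded N)
    (p : M) : ∀ᶠ x in 𝓝 p, inducedDist N p x ≠ ⊤ ∧ inducedDist N x p ≠ ⊤ := by
  have : IsManifold 𝓘(ℝ, E) 1 M := IsManifold.of_le (n := ∞) (by simp)
  obtain ⟨C, hC⟩ := hN p
  let e := extChartAt 𝓘(ℝ, E) p
  have hO : e.target ∩ e.symm ⁻¹' {x | ∀ v : TangentSpace 𝓘(ℝ, E) x,
      N ⟨x, v⟩ ≤ C * ‖(trivializationAt E (TangentSpace 𝓘(ℝ, E)) p ⟨x, v⟩).2‖} ∈ 𝓝 (e p) := by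
    refine inter_mem (extChartAt_target_mem_nhds p) ?_
    refine (continuousAt_extChartAt_symm p).preimage_mem_nhds ?_
    rw [extChartAt_to_inv]
    exact hC
  obtain ⟨r, hr, hball⟩ := Metric.mem_nhds_iff.1 hO
  -- Points of a chart ball are joined by the chart segment, whose coordinate velocity is the
  -- constant `z - y`. Its length is thus at most `C * ‖z - y‖`.
  have key : ∀ y ∈ Metric.ball (e p) r, ∀ z ∈ Metric.ball (e p) r,
      inducedDist N (e.symm y) (e.symm z) ≠ ⊤ := by
    intro y hy z hz
    let l : ℝ → E := fun s => y + s • (z - y)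
    have hl : ContDiff ℝ 1 l := contDiff_const.add (contDiff_id.smul contDiff_const)
    have hld : ∀ s, HasDerivAt l (z - y) s := fun s =>
      (((hasDerivAt_id (s : ℝ)).smul_const (z - y)).const_add y).congr_deriv (one_smul ℝ _)
    have hlb : ∀ s ∈ Icc (0 : ℝ) 1, l s ∈ Metric.ball (e p) r := fun s hs =>
      (convex_ball (e p) r).add_smul_sub_mem hy hz hs
    have hsm : ∀ s ∈ Icc (0 : ℝ) 1, ContMDiffAt 𝓘(ℝ, ℝ) 𝓘(ℝ, E) 1 (e.symm ∘ l) s := fun s hs =>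
      ContMDiffAt.comp (I' := 𝓘(ℝ, E)) s
        ((contMDiffOn_extChartAt_symm p).contMDiffAt
          ((isOpen_extChartAt_target p).mem_nhds (hball (hlb s hs)).1))
        hl.contMDiff.contMDiffAt
    have hle := inducedDist_le_curveLength N (γ := e.symm ∘ l)
      (ContMDiffOn.isPiecewiseC1 fun s hs => (hsm s hs).contMDiffWithinAt)
    have h0 : l 0 = y := by simp [l]
    have h1 : l 1 = z := by simp [l]
    rw [Function.comp, Function.comp, h0, h1] at hle
    refine ne_top_of_le_ne_top ?_ hle
    refine ne_top_of_le_ne_top (b := ∫⁻ s in Icc (0 : ℝ) 1, ENNReal.ofReal (C * ‖z - y‖)) (by simp)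
      ?_
    refine setLIntegral_mono' measurableSet_Icc fun s hs => ENNReal.ofReal_le_ofReal ?_
    have hb := hball (hlb s hs)
    have hsrc : (e.symm ∘ l) s ∈ (chartAt E p).source := by
      have := e.map_target hb.1
      rwa [extChartAt_source] at this
    have htr := trivializationAt_liftCurve ((hsm s hs).mdifferentiableAt one_ne_zero) hsrc
    have hd : deriv (e ∘ (e.symm ∘ l)) s = z - y := by
      have he : (e ∘ (e.symm ∘ l)) =ᶠ[𝓝 s] l := by
        have : ∀ᶠ σ in 𝓝 s, l σ ∈ e.target := hl.continuous.continuousAt.eventually_mem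
          ((isOpen_extChartAt_target p).mem_nhds hb.1)
        filter_upwards [this] with σ hσ using e.right_inv hσ
      rw [he.deriv_eq, (hld s).deriv]
    rw [hd] at htr
    rw [← htr]
    exact hb.2 _
  filter_upwards [(continuousAt_extChartAt (I := 𝓘(ℝ, E)) p).preimage_mem_nhds
    (Metric.ball_mem_nhds _ hr), extChartAt_source_mem_nhds (I := 𝓘(ℝ, E)) p] with x hx hxs
  have h1 := key _ (Metric.mem_ball_self hr) _ hx
  have h2 := key _ hx _ (Metric.mem_ball_self hr)
  rw [extChartAt_to_inv, e.left_inv hxs] at h1 h2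
  exact ⟨h1, h2⟩

/-- The points at finite distance from `a` form a clopen set. Without symmetry, openness uses paths
leaving a centre and closedness uses paths reaching it. -/
theorem isPseudoDistance_inducedDist {N : TangentBundle 𝓘(ℝ, E) M → ℝ}
    (hN : IsPosHomogeneous N) (hb : IsLocallyBounded N) : IsPseudoDistance (inducedDist N) where
  self := inducedDist_self hN
  triangle := inducedDist_triangle hN
  finite a b hab := by
    have hclopen : IsClopen {x | inducedDist N a x ≠ ⊤} := by
      constructor
      · refine ⟨isOpen_iff_mem_nhds.2 fun x hx => ?_⟩
        filter_upwards [eventually_inducedDist_ne_top hb x] with y hy hy'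
        exact hx (ne_top_of_le_ne_top (ENNReal.add_ne_top.2 ⟨hy', hy.2⟩)
          (inducedDist_triangle hN a y x))
      · refine isOpen_iff_mem_nhds.2 fun x hx => ?_
        filter_upwards [eventually_inducedDist_ne_top hb x] with y hy
        exact ne_top_of_le_ne_top (ENNReal.add_ne_top.2 ⟨hx, hy.1⟩) (inducedDist_triangle hN a x y)
    refine hclopen.connectedComponent_subset ?_ hab
    simp [inducedDist_self hN a]

end

/-! ### Horizontal and vertical frames, and local bounds from horizontal data -/

section Frames

variable {E : Type*} [NormedAddCommGroup E] [NormedSpace ℝ E]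
  {M : Type*} [TopologicalSpace M] [ChartedSpace E M] [IsManifold 𝓘(ℝ, E) ∞ M]

/-- In the chart at `p`, a distribution spanned by `C¹` vector fields is spanned by continuous
coordinate fields. -/
theorem IsSpannedByC1Fields.exists_coordinates {k : ℕ}
    {D : (x : M) → Submodule ℝ (TangentSpace 𝓘(ℝ, E) x)} (hD : IsSpannedByC1Fields k D) (p : M) :
    ∃ b : Fin k → M → E, (∀ i, ContinuousAt (b i) p) ∧
      ∀ᶠ x in 𝓝 p, ∀ v : TangentSpace 𝓘(ℝ, E) x, v ∈ D x ↔ ∃ c : Fin k → ℝ,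
        (⟨x, v⟩ : TangentBundle 𝓘(ℝ, E) M) = tangentMk p x (∑ i, c i • b i x) := by
  obtain ⟨O, hO, hpO, v, hv, hspan⟩ := hD p
  let T := trivializationAt E (TangentSpace 𝓘(ℝ, E)) p
  refine ⟨fun i x => (T ⟨x, v i x⟩).2, fun i => ?_, ?_⟩
  · have h1 : ContinuousAt (fun x => (⟨x, v i x⟩ : TangentBundle 𝓘(ℝ, E) M)) p :=
      ((hv i).continuousOn).continuousAt (hO.mem_nhds hpO)
    have h2 : ContinuousAt T (⟨p, v i p⟩ : TangentBundle 𝓘(ℝ, E) M) :=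
      T.toOpenPartialHomeomorph.continuousAt
        ((T.mem_source (x := ⟨p, v i p⟩)).2 (mem_chart_source E p))
    exact (ContinuousAt.comp (f := fun x => (⟨x, v i x⟩ : TangentBundle 𝓘(ℝ, E) M)) h2 h1).snd
  · filter_upwards [hO.mem_nhds hpO, chart_source_mem_nhds E p] with x hx hxs w
    have hb : ∀ i, T.symmL ℝ x (T ⟨x, v i x⟩).2 = v i x := fun i =>
      Bundle.TotalSpace.mk_inj.1 (tangentMk_trivialization (p := p) (z := ⟨x, v i x⟩) hxs)
    rw [hspan x hx, Submodule.mem_span_range_iff_exists_fun]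
    refine exists_congr fun c => ?_
    have e : T.symmL ℝ x (∑ i, c i • (T ⟨x, v i x⟩).2) = ∑ i, c i • v i x := by
      rw [map_sum]
      exact Finset.sum_congr rfl fun i _ => by rw [map_smul, hb]
    rw [← e]
    exact ⟨fun h => h ▸ rfl, fun h => (Bundle.TotalSpace.mk_inj.1 h).symm⟩

omit [IsManifold 𝓘(ℝ, E) ∞ M] [ChartedSpace E M] in
theorem continuousAt_sum_smul {k : ℕ} {b : Fin k → M → E} {p : M}
    (hb : ∀ i, ContinuousAt (b i) p) (c : Fin k → ℝ) :
    ContinuousAt (fun y : M × (Fin k → ℝ) => ∑ i, y.2 i • b i y.1) (p, c) :=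
  tendsto_finsetSum _ fun i _ =>
    (((continuous_apply i).comp continuous_snd).continuousAt).smul
      (ContinuousAt.comp (f := Prod.fst) (hb i) continuousAt_fst)

variable {V H : (x : M) → Submodule ℝ (TangentSpace 𝓘(ℝ, E) x)}

omit [IsManifold 𝓘(ℝ, E) ∞ M] in
theorem isPosHomogeneous_of_horizontal {N : TangentBundle 𝓘(ℝ, E) M → ℝ}
    (hVH : ∀ x, IsCompl (V x) (H x))
    (hN : ∀ (x : M), ∀ δh ∈ H x, ∀ δv ∈ V x, N ⟨x, δh + δv⟩ = N ⟨x, δh⟩)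
    (hom : ∀ (x : M), ∀ δ ∈ H x, ∀ l : ℝ, 0 < l → N ⟨x, l • δ⟩ = l * N ⟨x, δ⟩) :
    IsPosHomogeneous N := by
  intro x w l hl
  obtain ⟨v, hv, h, hh, rfl⟩ := Submodule.mem_sup.1
    ((hVH x).sup_eq_top ▸ Submodule.mem_top : w ∈ V x ⊔ H x)
  rw [add_comm v h, smul_add, hN x _ ((H x).smul_mem l hh) _ ((V x).smul_mem l hv),
    hom x h hh l hl, hN x h hh v hv]

/-- A function which factors through the horizontal distribution, is positively homogeneous, and is
continuous at nonzero horizontal vectors is locally bounded. -/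
theorem isLocallyBounded_of_horizontal [FiniteDimensional ℝ E] {N : TangentBundle 𝓘(ℝ, E) M → ℝ}
    (hVH : IsSubdivision V H)
    (hcont : ∀ (x : M), ∀ δ ∈ H x, δ ≠ 0 → ContinuousAt N ⟨x, δ⟩)
    (hN : ∀ (x : M), ∀ δh ∈ H x, ∀ δv ∈ V x, N ⟨x, δh + δv⟩ = N ⟨x, δh⟩)
    (hom : ∀ (x : M), ∀ δ ∈ H x, ∀ l : ℝ, 0 < l → N ⟨x, l • δ⟩ = l * N ⟨x, δ⟩) :
    IsLocallyBounded N := by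
  intro p
  obtain ⟨⟨r, q, -, -, hrq, hV, hH⟩, hcompl⟩ := hVH
  have hposhom := isPosHomogeneous_of_horizontal hcompl hN hom
  obtain ⟨a, ha, haV⟩ := hV.exists_coordinates p
  obtain ⟨b, hb, hbH⟩ := hH.exists_coordinates p
  let T := trivializationAt E (TangentSpace 𝓘(ℝ, E)) p
  let A : M → ((Fin r → ℝ) × (Fin q → ℝ)) →ₗ[ℝ] E := fun x =>
    (Fintype.linearCombination ℝ (fun i => a i x)).coprod
      (Fintype.linearCombination ℝ (fun j => b j x))
  have hA : ∀ x c d, A x (c, d) = ∑ i, c i • a i x + ∑ j, d j • b j x := fun x c d => by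
    simp [A, Fintype.linearCombination_apply]
  have hdec : ∀ᶠ x in 𝓝 p, ∀ w : TangentSpace 𝓘(ℝ, E) x, ∃ c d,
      (T ⟨x, w⟩).2 = A x (c, d) ∧ N ⟨x, w⟩ = N (tangentMk p x (∑ j, d j • b j x)) := by
    filter_upwards [haV, hbH, chart_source_mem_nhds E p] with x hxV hxH hxs w
    obtain ⟨v, hv, h, hh, rfl⟩ := Submodule.mem_sup.1
      ((hcompl x).sup_eq_top ▸ Submodule.mem_top : w ∈ V x ⊔ H x)
    obtain ⟨c, hc⟩ := (hxV v).1 hv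
    obtain ⟨d, hd⟩ := (hxH h).1 hh
    refine ⟨c, d, ?_, ?_⟩
    · rw [hA]
      have hc' := Bundle.TotalSpace.mk_inj.1 hc
      have hd' := Bundle.TotalSpace.mk_inj.1 hd
      rw [hc', hd', ← map_add]
      exact trivialization_tangentMk hxs _
    · rw [← hd, add_comm v h, hN x h hh v hv]
  have hsurj : Function.Surjective (A p) := fun w => by
    obtain ⟨c, d, h, -⟩ := hdec.self_of_nhds (tangentMk p p w).snd
    refine ⟨(c, d), h.symm.trans ?_⟩
    exact trivialization_tangentMk (mem_chart_source E p) w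
  -- Surjectivity gives `dim E ≤ r + q`, and the reverse inequality is assumed. So the spanning
  -- fields form a basis over `p`.
  have hinj : Function.Injective (A p) := by
    refine (LinearMap.injective_iff_surjective_of_finrank_eq_finrank ?_).2 hsurj
    have h1 := LinearMap.finrank_range_le (A p)
    rw [LinearMap.range_eq_top.2 hsurj, finrank_top] at h1
    simp only [Module.finrank_prod, Module.finrank_fin_fun] at h1 ⊢
    omega
  have hacont : ∀ c : Fin r → ℝ,
      ContinuousAt (fun y : M × (Fin r → ℝ) => ∑ i, y.2 i • a i y.1) (p, c) := fun c =>
    continuousAt_sum_smul ha c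
  have hbcont : ∀ d : Fin q → ℝ,
      ContinuousAt (fun y : M × (Fin q → ℝ) => ∑ j, y.2 j • b j y.1) (p, d) := fun d =>
    continuousAt_sum_smul hb d
  have hAcont : ∀ z,
      ContinuousAt (fun y : M × ((Fin r → ℝ) × (Fin q → ℝ)) => A y.1 y.2) (p, z) := by
    rintro ⟨c, d⟩
    have e : (fun y : M × ((Fin r → ℝ) × (Fin q → ℝ)) => A y.1 y.2) = fun y =>
      ∑ i, y.2.1 i • a i y.1 + ∑ j, y.2.2 j • b j y.1 := funext fun y => hA y.1 y.2.1 y.2.2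
    rw [e]
    exact (ContinuousAt.comp (f := fun y : M × ((Fin r → ℝ) × (Fin q → ℝ)) => (y.1, y.2.1))
        (x := (p, (c, d)))
        (hacont c) (by fun_prop)).add
      (ContinuousAt.comp (f := fun y : M × ((Fin r → ℝ) × (Fin q → ℝ)) => (y.1, y.2.2))
        (x := (p, (c, d)))
        (hbcont d) (by fun_prop))
  obtain ⟨ε, hε, hlow⟩ : ∃ ε > 0, ∀ᶠ x in 𝓝 p, ∀ z, ε * ‖z‖ ≤ ‖A x z‖ := by
    obtain ⟨κ, hκ, hanti⟩ := (A p).exists_antilipschitzWith (LinearMap.ker_eq_bot.2 hinj)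
    refine ⟨(2 * κ : ℝ)⁻¹, by positivity, ?_⟩
    -- A lower bound for `‖A x z‖` is an upper bound for its negative. Halving the constant `κ⁻¹`
    -- valid at `p` makes the inequality strict, so that it persists nearby.
    have h := eventually_forall_lt_mul_norm (g := fun x z => -‖A x z‖) (x₀ := p)
      (C := -(2 * κ : ℝ)⁻¹)
      (Eventually.of_forall fun x w l hl => by
        rw [map_smul, norm_smul, Real.norm_of_nonneg hl.le, mul_neg])
      (fun z _ => (hAcont z).norm.neg) (fun z hz => by
        have h1 := hanti.le_mul_dist z 0
        rw [dist_zero_right, map_zero, dist_zero_right, hz] at h1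
        have hκ' : (0 : ℝ) < κ := hκ
        rw [neg_lt_neg_iff, inv_lt_iff_one_lt_mul₀ (by positivity)]
        linarith)
    filter_upwards [h] with x hx z
    by_cases hz : z = 0
    · simp [hz]
    · have := hx z hz
      linarith
  -- Continuity of `N` is known only at nonzero horizontal vectors, so `N` is bounded through the
  -- horizontal coordinates `d` alone. Injectivity of `A p` ensures that `d ≠ 0` gives a nonzero
  -- vector.
  have hNcont : ∀ d : Fin q → ℝ, d ≠ 0 → ContinuousAt
      (fun y : M × (Fin q → ℝ) => N (tangentMk p y.1 (∑ j, y.2 j • b j y.1))) (p, d) := by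
    intro d hd
    have hmem : (tangentMk p p (∑ j, d j • b j p)).snd ∈ H p :=
      (hbH.self_of_nhds _).2 ⟨d, rfl⟩
    have hne : (tangentMk p p (∑ j, d j • b j p)).snd ≠ 0 := by
      refine tangentMk_snd_ne_zero fun h0 => hd ?_
      have e : A p (0, d) = A p 0 := by
        rw [hA, h0, map_zero]
        simp
      exact congrArg Prod.snd (hinj e)
    have h1 : ContinuousAt (fun y : M × (Fin q → ℝ) => (y.1, ∑ j, y.2 j • b j y.1)) (p, d) :=
      continuousAt_fst.prodMk (hbcont d)
    have h2 := ContinuousAt.comp (f := fun y : M × (Fin q → ℝ) => (y.1, ∑ j, y.2 j • b j y.1))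
      (continuousAt_tangentMk (mem_chart_source E p) (∑ j, d j • b j p)) h1
    exact ContinuousAt.comp (g := N) (hcont p _ hmem hne) h2
  obtain ⟨C, hC0, hC⟩ := exists_forall_norm_eq_one_lt (W := Fin q → ℝ)
    (g := fun d => N (tangentMk p p (∑ j, d j • b j p))) (fun d hd =>
      ContinuousAt.comp (f := fun d : Fin q → ℝ => (p, d))
        (hNcont d (by rintro rfl; simp at hd)) (by fun_prop))
  have hup := eventually_forall_lt_mul_norm (x₀ := p)
    (g := fun x (d : Fin q → ℝ) => N (tangentMk p x (∑ j, d j • b j x)))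
    (Eventually.of_forall fun x d l hl => by
      have e : ∑ j, (l • d) j • b j x = l • ∑ j, d j • b j x := by
        simp [Finset.smul_sum, smul_smul]
      rw [e, tangentMk_smul, hposhom _ _ l hl]
      rfl)
    (fun d hd => hNcont d (by rintro rfl; simp at hd)) hC
  refine ⟨C * ε⁻¹, ?_⟩
  filter_upwards [hdec, hlow, hup] with x hxd hxl hxu w
  obtain ⟨c, d, h1, h2⟩ := hxd w
  rw [h2, h1]
  have h3 : N (tangentMk p x (∑ j, d j • b j x)) ≤ C * ‖d‖ := by
    by_cases hd : d = 0
    · subst hd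
      simp [tangentMk, hposhom.map_zero]
    · exact (hxu d hd).le
  have h4 : ‖d‖ ≤ ε⁻¹ * ‖A x (c, d)‖ := by
    rw [inv_mul_eq_div, le_div_iff₀' hε]
    refine le_trans ?_ (hxl (c, d))
    gcongr
    exact le_max_right _ _
  calc _ ≤ C * ‖d‖ := h3
    _ ≤ C * (ε⁻¹ * ‖A x (c, d)‖) := by gcongr
    _ = _ := by ring

end Frames

/-! ### Separation of points by bump functions -/

section Separation

variable {E : Type*} [NormedAddCommGroup E] [NormedSpace ℝ E] [FiniteDimensional ℝ E]
  {M : Type*} [TopologicalSpace M] [ChartedSpace E M] [IsManifold 𝓘(ℝ, E) ∞ M]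
  {K : TangentBundle 𝓘(ℝ, E) M → ℝ}

/-- A positively homogeneous function on the tangent bundle which is continuous and negative at the
nonzero vectors over `p` is negative at the nonzero vectors over all nearby points. -/
theorem eventually_forall_neg {G : TangentBundle 𝓘(ℝ, E) M → ℝ} (hom : IsPosHomogeneous G) {p : M}
    (hcont : ∀ v : TangentSpace 𝓘(ℝ, E) p, v ≠ 0 → ContinuousAt G ⟨p, v⟩)
    (hneg : ∀ v : TangentSpace 𝓘(ℝ, E) p, v ≠ 0 → G ⟨p, v⟩ < 0) :
    ∀ᶠ x in 𝓝 p, ∀ v : TangentSpace 𝓘(ℝ, E) x, v ≠ 0 → G ⟨x, v⟩ < 0 := by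
  have h := eventually_forall_lt_mul_norm (W := E) (g := fun x w => G (tangentMk p x w))
    (x₀ := p) (C := 0)
    (Eventually.of_forall fun x w l hl => by
      rw [tangentMk_smul, hom _ _ l hl]
      rfl)
    (fun w hw => ContinuousAt.comp (g := G) (f := fun z : M × E => tangentMk p z.1 z.2)
      (hcont _ (tangentMk_snd_ne_zero (norm_ne_zero_iff.1 (by rw [hw]; exact one_ne_zero))))
      (continuousAt_tangentMk (mem_chart_source E p) w))
    (fun w hw =>
      hneg _ (tangentMk_snd_ne_zero (norm_ne_zero_iff.1 (by rw [hw]; exact one_ne_zero))))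
  filter_upwards [h, chart_source_mem_nhds E p] with x hx hxs v hv
  have e := tangentMk_trivialization (p := p) (z := ⟨x, v⟩) hxs
  have hne : (trivializationAt E (TangentSpace 𝓘(ℝ, E)) p ⟨x, v⟩).2 ≠ 0 := by
    intro h0
    rw [h0] at e
    exact hv ((Bundle.TotalSpace.mk_inj.1 e).symm.trans (map_zero _))
  have := hx _ hne
  rw [e] at this
  simpa using this

/-- The differential of a real-valued function, as a function on the tangent bundle. -/
def differential (ρ : M → ℝ) (z : TangentBundle 𝓘(ℝ, E) M) : ℝ :=
  mfderiv 𝓘(ℝ, E) 𝓘(ℝ, ℝ) ρ z.proj z.2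

omit [FiniteDimensional ℝ E] in
theorem continuous_differential {ρ : M → ℝ} (hρ : ContMDiff 𝓘(ℝ, E) 𝓘(ℝ, ℝ) 1 ρ) :
    Continuous (differential (E := E) ρ) := by
  have : IsManifold 𝓘(ℝ, E) 1 M := IsManifold.of_le (n := ∞) (by simp)
  have h1 : Continuous (tangentMap 𝓘(ℝ, E) 𝓘(ℝ, ℝ) ρ) := hρ.continuous_tangentMap le_rfl
  have h2 : Continuous fun z : TangentBundle 𝓘(ℝ, ℝ) ℝ => (z.2 : ℝ) :=
    (contMDiff_snd_tangentBundle_modelSpace (n := 0) ℝ 𝓘(ℝ, ℝ)).continuous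
  exact h2.comp h1

omit [FiniteDimensional ℝ E] [IsManifold 𝓘(ℝ, E) ∞ M] in
theorem differential_smul (ρ : M → ℝ) (x : M) (v : TangentSpace 𝓘(ℝ, E) x) (l : ℝ) :
    differential ρ (⟨x, l • v⟩ : TangentBundle 𝓘(ℝ, E) M) = l * differential (E := E) ρ ⟨x, v⟩ :=
  (mfderiv 𝓘(ℝ, E) 𝓘(ℝ, ℝ) ρ x).map_smul l v

/-- Near a point over which `K` is positive, the differential of a `C¹` function is bounded by a
multiple of `K`. -/
theorem eventually_abs_differential_le (hom : IsPosHomogeneous K)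
    (hcont : ∀ (x : M) (v : TangentSpace 𝓘(ℝ, E) x), v ≠ 0 → ContinuousAt K ⟨x, v⟩)
    {ρ : M → ℝ} (hρ : ContMDiff 𝓘(ℝ, E) 𝓘(ℝ, ℝ) 1 ρ) {p : M}
    (hpos : ∀ v : TangentSpace 𝓘(ℝ, E) p, v ≠ 0 → 0 < K ⟨p, v⟩) :
    ∃ C > 0, ∀ᶠ x in 𝓝 p, ∀ v : TangentSpace 𝓘(ℝ, E) x,
      |differential (E := E) ρ ⟨x, v⟩| ≤ C * K ⟨x, v⟩ := by
  have hne : ∀ w : E, ‖w‖ = 1 → w ≠ 0 := fun w hw =>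
    norm_ne_zero_iff.1 (by rw [hw]; exact one_ne_zero)
  have hd := continuous_differential (E := E) hρ
  have hmk : ∀ w : E, ContinuousAt (fun w : E => tangentMk p p w) w := fun w =>
    ContinuousAt.comp (f := fun w : E => (p, w)) (continuousAt_tangentMk (mem_chart_source E p) w)
      (by fun_prop)
  obtain ⟨C, hC0, hC⟩ := exists_forall_norm_eq_one_lt (W := E)
    (g := fun w => |differential ρ (tangentMk p p w)| / K (tangentMk p p w)) (fun w hw =>
      ((hd.abs.continuousAt.comp (hmk w))).div
        (ContinuousAt.comp (g := K) (hcont _ _ (tangentMk_snd_ne_zero (hne w hw))) (hmk w))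
        (hpos _ (tangentMk_snd_ne_zero (hne w hw))).ne')
  -- With `C` above the ratio `|dρ| / K` on the unit sphere over `p`, this difference is negative on
  -- nonzero vectors over `p`, hence over nearby points.
  have homG : IsPosHomogeneous fun z => |differential ρ z| - C * K z := by
    intro x v l hl
    simp only [differential_smul, hom x v l hl, abs_mul, abs_of_pos hl]
    ring
  have hlt : ∀ v : TangentSpace 𝓘(ℝ, E) p, v ≠ 0 →
      |differential (E := E) ρ ⟨p, v⟩| - C * K ⟨p, v⟩ < 0 := by
    intro v hv
    let w := (trivializationAt E (TangentSpace 𝓘(ℝ, E)) p ⟨p, v⟩).2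
    have e : tangentMk p p w = ⟨p, v⟩ :=
      tangentMk_trivialization (z := ⟨p, v⟩) (mem_chart_source E p)
    have hw : w ≠ 0 := by
      intro h0
      rw [h0] at e
      exact hv ((Bundle.TotalSpace.mk_inj.1 e).symm.trans (map_zero _))
    have hw' : 0 < ‖w‖ := norm_pos_iff.2 hw
    have h1 : ‖‖w‖⁻¹ • w‖ = 1 := by simp [norm_smul, hw'.ne']
    have h2 := hC _ h1
    have h5 : 0 < K (tangentMk p p (‖w‖⁻¹ • w)) := hpos _ (tangentMk_snd_ne_zero (hne _ h1))
    rw [div_lt_iff₀ h5, tangentMk_smul] at h2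
    have h3 := homG p (tangentMk p p w).snd _ (inv_pos.2 hw')
    have h4 : ‖w‖⁻¹ * (|differential ρ (tangentMk p p w)| - C * K (tangentMk p p w)) < 0 :=
      h3.symm.trans_lt (sub_neg.2 h2)
    rw [e] at h4
    exact (pos_iff_neg_of_mul_neg h4).1 (inv_pos.2 hw')
  refine ⟨C, hC0, ?_⟩
  filter_upwards [eventually_forall_neg homG
    (fun v hv => (hd.abs.continuousAt).sub ((hcont p v hv).const_mul C)) hlt] with x hx v
  by_cases hv : v = 0
  · subst hv
    have h0 : differential (E := E) ρ ⟨x, 0⟩ = 0 := (mfderiv 𝓘(ℝ, E) 𝓘(ℝ, ℝ) ρ x).map_zero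
    rw [hom.map_zero, h0, abs_zero, mul_zero]
  · exact (sub_neg.1 (hx v hv)).le

/-- The distance induced by a positively homogeneous function `K`, continuous at
nonzero vectors, separates points if `K` is definite away from a discrete set. -/
theorem separates_inducedDist [T2Space M] {Ω : Set M} (hΩ : DiscreteTopology Ω)
    (hom : IsPosHomogeneous K) (hK0 : ∀ z, 0 ≤ K z)
    (hcont : ∀ (x : M) (v : TangentSpace 𝓘(ℝ, E) x), v ≠ 0 → ContinuousAt K ⟨x, v⟩)
    (hpos : ∀ x ∉ Ω, ∀ v : TangentSpace 𝓘(ℝ, E) x, v ≠ 0 → 0 < K ⟨x, v⟩) :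
    Separates (inducedDist K) := by
  intro a b hab
  by_contra hne
  -- If `a ∈ Ω`, isolation keeps nearby points other than `a` out of `Ω`. If `a ∉ Ω`, definiteness
  -- at `a` spreads to a neighbourhood; this does not require `Ω` to be closed.
  have hO : ∀ᶠ x in 𝓝 a, x ≠ a → ∀ v : TangentSpace 𝓘(ℝ, E) x, v ≠ 0 → 0 < K ⟨x, v⟩ := by
    by_cases ha : a ∈ Ω
    · obtain ⟨O, hO, hOa⟩ := discreteTopology_subtype_iff'.1 hΩ a ha
      filter_upwards [hO.mem_nhds (show a ∈ O from (hOa.symm ▸ mem_singleton a : a ∈ O ∩ Ω).1)]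
        with x hx hxa
      exact hpos x fun hxΩ => hxa (hOa ▸ ⟨hx, hxΩ⟩ : x ∈ ({a} : Set M))
    · have homneg : IsPosHomogeneous fun z => -K z := fun x v l hl => by
        simp only [hom x v l hl, mul_neg]
      filter_upwards [eventually_forall_neg homneg (fun v hv => (hcont a v hv).neg)
        (fun v hv => neg_neg_of_pos (hpos a ha v hv))] with x hx _ v hv
      exact neg_neg_iff_pos.1 (hx v hv)
  obtain ⟨ρ, -, hρ⟩ := (SmoothBumpFunction.nhds_basis_tsupport (I := 𝓘(ℝ, E)) a).mem_iff.1
    (inter_mem hO (compl_singleton_mem_nhds (Ne.symm hne).symm))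
  have hρ1 : ContMDiff 𝓘(ℝ, E) 𝓘(ℝ, ℝ) 1 ρ := ρ.contMDiff.of_le (by simp)
  have hconst : ∀ (c : ℝ) (x : M), ⇑ρ =ᶠ[𝓝 x] (fun _ => c) →
      ∀ᶠ y in 𝓝 x, ∀ v : TangentSpace 𝓘(ℝ, E) y, differential (E := E) ρ ⟨y, v⟩ = 0 := by
    intro c x hx
    filter_upwards [hx.eventuallyEq_nhds] with y hy v
    exact DFunLike.congr_fun ((hy.mfderiv_eq (I := 𝓘(ℝ, E)) (I' := 𝓘(ℝ, ℝ))).trans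
      mfderiv_const) v
  -- Local constants are merged by compactness. Near `a` any constant works because `ρ` is locally
  -- `1` and its differential vanishes, which compensates for a possible degeneracy of `K` over `a`.
  have hcomp : ∃ C > 0, ∀ x ∈ tsupport ρ, ∀ v : TangentSpace 𝓘(ℝ, E) x,
      |differential (E := E) ρ ⟨x, v⟩| ≤ C * K ⟨x, v⟩ := by
    refine IsCompact.induction_on (p := fun s => ∃ C > 0, ∀ x ∈ s, ∀ v : TangentSpace 𝓘(ℝ, E) x,
      |differential (E := E) ρ ⟨x, v⟩| ≤ C * K ⟨x, v⟩) ρ.hasCompactSupport ⟨1, one_pos, by simp⟩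
      ?_ ?_ ?_
    · rintro s t hst ⟨C, hC, h⟩
      exact ⟨C, hC, fun x hx => h x (hst hx)⟩
    · rintro s t ⟨C, hC, h⟩ ⟨C', hC', h'⟩
      refine ⟨max C C', lt_max_of_lt_left hC, ?_⟩
      rintro x (hx | hx) v
      · exact (h x hx v).trans (mul_le_mul_of_nonneg_right (le_max_left _ _) (hK0 _))
      · exact (h' x hx v).trans (mul_le_mul_of_nonneg_right (le_max_right _ _) (hK0 _))
    · intro x hx
      by_cases hxa : x = a
      · subst hxa
        have h := hconst 1 x ρ.eventuallyEq_one
        refine ⟨_, mem_nhdsWithin_of_mem_nhds h, 1, one_pos, fun y hy v => ?_⟩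
        rw [hy v, abs_zero, one_mul]
        exact hK0 _
      · obtain ⟨C, hC, h⟩ := eventually_abs_differential_le hom hcont hρ1 ((hρ hx).1 hxa)
        exact ⟨_, mem_nhdsWithin_of_mem_nhds h, C, hC, fun y hy => hy⟩
  obtain ⟨C, hC, h⟩ := hcomp
  have hall : ∀ (x : M) (v : TangentSpace 𝓘(ℝ, E) x),
      |differential (E := E) ρ ⟨x, v⟩| ≤ C * K ⟨x, v⟩ := by
    intro x v
    by_cases hx : x ∈ tsupport ρ
    · exact h x hx v
    · have h0 : ⇑ρ =ᶠ[𝓝 x] (fun _ => 0) := notMem_tsupport_iff_eventuallyEq.1 hx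
      rw [(hconst 0 x h0).self_of_nhds v, abs_zero]
      exact mul_nonneg hC.le (hK0 _)
  have hle := enorm_sub_le_inducedDist hρ1 hC hall a b
  have hb : ρ b = 0 := image_eq_zero_of_notMem_tsupport fun hb => (hρ hb).2 rfl
  rw [hab, hb, ρ.eq_one] at hle
  simp at hle

end Separation

/-! ### Induced distances under maps and under comparison of integrands -/

section Comparison

variable {E : Type*} [NormedAddCommGroup E] [NormedSpace ℝ E]
  {M : Type*} [TopologicalSpace M] [ChartedSpace E M]

/-- The image under `f` of a curve from `a` to `b` competes for the distance of the images, and its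
length grows at most by `L`. Positivity of `L` avoids `0 * ⊤` when the constant enters the infimum.
-/
theorem inducedDist_comp_le {N : TangentBundle 𝓘(ℝ, E) M → ℝ} {f : M → M}
    (hf : ContMDiff 𝓘(ℝ, E) 𝓘(ℝ, E) 1 f) {L : ℝ≥0} (hL : 0 < L)
    (hN : ∀ z, N (tangentMap 𝓘(ℝ, E) 𝓘(ℝ, E) f z) ≤ L * N z) (a b : M) :
    inducedDist N (f a) (f b) ≤ L * inducedDist N a b := by
  conv_rhs => unfold inducedDist
  simp only [ENNReal.mul_iInf_of_ne (ENNReal.coe_ne_zero.2 hL.ne') ENNReal.coe_ne_top]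
  refine le_iInf₂ fun γ => ?_
  rintro ⟨hγ, rfl, rfl⟩
  refine (inducedDist_le_curveLength N (hγ.comp hf)).trans ?_
  rw [curveLength, curveLength, ← lintegral_const_mul' _ _ ENNReal.coe_ne_top]
  refine lintegral_mono_ae ?_
  filter_upwards [hγ.ae_contMDiffAt] with s hs
  rw [liftCurve_comp (hf.contMDiffAt.mdifferentiableAt one_ne_zero)
    (hs.mdifferentiableAt one_ne_zero), ← ENNReal.ofReal_coe_nnreal,
    ← ENNReal.ofReal_mul L.coe_nonneg]
  exact ENNReal.ofReal_le_ofReal (hN _)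

theorem const_mul_inducedDist_le {N K : TangentBundle 𝓘(ℝ, E) M → ℝ} {c : ℝ} (hc : 0 < c)
    (h : ∀ z, c * K z ≤ N z) (a b : M) :
    ENNReal.ofReal c * inducedDist K a b ≤ inducedDist N a b := by
  refine le_iInf₂ fun γ hγ => ?_
  refine (mul_le_mul_right (iInf₂_le γ hγ) _).trans ?_
  rw [curveLength, curveLength, ← lintegral_const_mul' _ _ ENNReal.ofReal_ne_top]
  refine lintegral_mono fun s => ?_
  rw [← ENNReal.ofReal_mul hc.le]
  exact ENNReal.ofReal_le_ofReal (h _)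

theorem isClassK_const_mul {L : ℝ≥0} (hL : 0 < L) : IsClassK fun r => L * r where
  locallyLipschitz :=
    (LipschitzWith.of_dist_le_mul fun x y => by
      rw [NNReal.dist_eq, NNReal.dist_eq, NNReal.coe_mul, NNReal.coe_mul, ← mul_sub, abs_mul,
        NNReal.abs_eq] : LipschitzWith L fun r : ℝ≥0 => L * r).locallyLipschitz
  strictMono := fun a b hab => mul_lt_mul_of_pos_left hab hL
  map_zero := mul_zero L

end Comparison

/-! ### Incremental stability from contraction of the storage -/

section Stability

variable {E : Type*} [NormedAddCommGroup E] [NormedSpace ℝ E]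
  {M : Type*} [TopologicalSpace M] [ChartedSpace E M] [IsManifold 𝓘(ℝ, E) ∞ M]
  {E₁ : Type*} [NormedAddCommGroup E₁] [NormedSpace ℝ E₁]
  {U : Type*} [TopologicalSpace U] [ChartedSpace E₁ U] [IsManifold 𝓘(ℝ, E₁) ∞ U]
  {E₂ : Type*} [NormedAddCommGroup E₂] [NormedSpace ℝ E₂]
  {Y : Type*} [TopologicalSpace Y] [ChartedSpace E₂ Y] [IsManifold 𝓘(ℝ, E₂) ∞ Y]
  {m : ℕ} {F : TangentBundle 𝓘(ℝ, E) M × (U × Y) → EuclideanSpace ℝ (Fin m)} {J : Set ℝ}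
  {Q : M → TangentBundle 𝓘(ℝ, E₁) U → TangentBundle 𝓘(ℝ, E₂) Y → ℝ}
  {S N : TangentBundle 𝓘(ℝ, E) M → ℝ}

/-- If `N` grows at most by a constant factor wherever the dissipated storage function `S` does not
increase, then the system is incrementally stable for the distance induced by `N`. -/
theorem isIncrementallyStable_inducedDist
    (hF : ContMDiff (𝓘(ℝ, E).tangent.prod (𝓘(ℝ, E₁).prod 𝓘(ℝ, E₂)))
      𝓘(ℝ, EuclideanSpace ℝ (Fin m)) 1 F)
    (hJ : Ici 0 ⊆ J) (hwp : IsWellPosed E₁ E₂ F J) (hdiss : IsDissipationInequality F J S Q)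
    (hQ0 : ∀ (x : M) (u : U) (ν : TangentBundle 𝓘(ℝ, E₂) Y), Q x ⟨u, 0⟩ ν = 0)
    {L : ℝ≥0} (hL : 0 < L) (hN : ∀ z w, S w ≤ S z → N w ≤ L * N z) :
    IsIncrementallyStable E₁ E₂ F J (inducedDist N) := by
  refine ⟨fun r => L * r, isClassK_const_mul hL, ?_⟩
  intro x₁ x₂ u₁ u₂ y₁ y₂ h₁ h₂ hu hfin t ht
  obtain ⟨φ, η, hφ, hη, hsol⟩ := hwp.existence u₁ h₁.input
  -- Both solutions are flow lines of one flow, that of `u₁`: uniqueness asks for equal inputs only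
  -- on `J`.
  have hx : ∀ (x : ℝ → M) (u : ℝ → U) (y : ℝ → Y), InBehavior E₁ E₂ F J x u y → EqOn u₁ u J →
      φ (t, x 0) = x t := fun x u y h hu =>
    hwp.uniqueness _ _ _ _ _ _ (hsol (x 0)).2 h hu (hsol (x 0)).1 (hJ ht)
  rw [← hx x₁ u₁ y₁ h₁ (eqOn_refl _ _), ← hx x₂ u₂ y₂ h₂ hu, ENNReal.coe_mul,
    ENNReal.coe_toNNReal hfin]
  refine inducedDist_comp_le (f := fun x => φ (t, x)) ?_ hL (fun z => ?_) _ _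
  · exact (hφ.of_le (by norm_num)).comp (contMDiff_const.prodMk contMDiff_id)
  · exact hN _ _ (storage_tangentMap_le hF hdiss hQ0 hφ hη hsol z ht)

end Stability

/-! ### Comparison of `K` with `S^(1/p)` -/

section Storage

variable {E : Type*} [NormedAddCommGroup E] [NormedSpace ℝ E]
  {M : Type*} [TopologicalSpace M] [ChartedSpace E M] [IsManifold 𝓘(ℝ, E) ∞ M]
  {Ω : Set M} {V H : (x : M) → Submodule ℝ (TangentSpace 𝓘(ℝ, E) x)}
  {S K : TangentBundle 𝓘(ℝ, E) M → ℝ} {p c₁ c₂ : ℝ}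

namespace IsDifferentialStorage

theorem p_pos (hS : IsDifferentialStorage Ω V H S K p c₁ c₂) : 0 < p :=
  one_pos.trans_le hS.one_le_p

theorem const_mul_rpow (hS : IsDifferentialStorage Ω V H S K p c₁ c₂) {c : ℝ} (hc : 0 ≤ c)
    (z : TangentBundle 𝓘(ℝ, E) M) : (c * K z ^ p) ^ (1 / p) = c ^ (1 / p) * K z := by
  rw [Real.mul_rpow hc (Real.rpow_nonneg (hS.K_nonneg z) p), ← Real.rpow_mul (hS.K_nonneg z),
    mul_one_div_cancel hS.p_pos.ne', Real.rpow_one]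

theorem rpow_le (hS : IsDifferentialStorage Ω V H S K p c₁ c₂) (z : TangentBundle 𝓘(ℝ, E) M) :
    S z ^ (1 / p) ≤ c₂ ^ (1 / p) * K z := by
  rw [← hS.const_mul_rpow hS.c₂_nonneg]
  exact Real.rpow_le_rpow (hS.S_nonneg z) (hS.upper z) (one_div_pos.2 hS.p_pos).le

theorem le_rpow (hS : IsDifferentialStorage Ω V H S K p c₁ c₂) (z : TangentBundle 𝓘(ℝ, E) M) :
    c₁ ^ (1 / p) * K z ≤ S z ^ (1 / p) := by
  rw [← hS.const_mul_rpow hS.c₁_nonneg]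
  exact Real.rpow_le_rpow (mul_nonneg hS.c₁_nonneg (Real.rpow_nonneg (hS.K_nonneg z) p))
    (hS.lower z) (one_div_pos.2 hS.p_pos).le

theorem isPosHomogeneous_K (hS : IsDifferentialStorage Ω V H S K p c₁ c₂) : IsPosHomogeneous K :=
  isPosHomogeneous_of_horizontal hS.subdivision.isCompl hS.K_horizontal hS.K_homogeneous

theorem isPosHomogeneous_rpow (hS : IsDifferentialStorage Ω V H S K p c₁ c₂)
    (hhom : IsHomogeneousOfDegree H S p) : IsPosHomogeneous fun ξ => S ξ ^ (1 / p) :=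
  isPosHomogeneous_of_horizontal hS.subdivision.isCompl
    (fun x δh hδh δv hδv => by simp only [hS.S_horizontal x δh hδh δv hδv])
    (fun x δ hδ l hl => by
      simp only [hhom x δ hδ l hl]
      rw [Real.mul_rpow (Real.rpow_nonneg hl.le p) (hS.S_nonneg _), ← Real.rpow_mul hl.le,
        mul_one_div_cancel hS.p_pos.ne', Real.rpow_one])

theorem isLocallyBounded_K [FiniteDimensional ℝ E]
    (hS : IsDifferentialStorage Ω V H S K p c₁ c₂) : IsLocallyBounded K :=
  isLocallyBounded_of_horizontal hS.subdivision
    (fun x δ hδ hne => (hS.K_contMDiffAt x δ hδ hne).continuousAt) hS.K_horizontal hS.K_homogeneous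

/-- The bound is inherited from `K` through `S ≤ c₂ K^p`, so no homogeneity of `S` enters. -/
theorem isLocallyBounded_rpow [FiniteDimensional ℝ E]
    (hS : IsDifferentialStorage Ω V H S K p c₁ c₂) :
    IsLocallyBounded fun ξ => S ξ ^ (1 / p) := by
  intro x
  obtain ⟨C, hC⟩ := hS.isLocallyBounded_K x
  refine ⟨c₂ ^ (1 / p) * C, ?_⟩
  filter_upwards [hC] with y hy v
  rw [mul_assoc]
  exact (hS.rpow_le _).trans
    (mul_le_mul_of_nonneg_left (hy v) (Real.rpow_nonneg hS.c₂_nonneg _))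

theorem separates_K [FiniteDimensional ℝ E] [T2Space M]
    (hS : IsDifferentialStorage Ω V H S K p c₁ c₂) (hH : ∀ x, H x = ⊤) :
    Separates (inducedDist K) :=
  have hmem : ∀ (x : M) (v : TangentSpace 𝓘(ℝ, E) x), v ∈ H x := fun x _ => hH x ▸ trivial
  separates_inducedDist hS.isolated hS.isPosHomogeneous_K hS.K_nonneg
    (fun x v hv => (hS.K_contMDiffAt x v (hmem x v) hv).continuousAt)
    (fun x hx v hv => hS.K_pos x hx v (hmem x v) hv)

/-- The chain is `c₁^(1/p) K(w) ≤ S(w)^(1/p) ≤ S(z)^(1/p) ≤ c₂^(1/p) K(z)`. -/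
theorem K_le_of_S_le (hS : IsDifferentialStorage Ω V H S K p c₁ c₂) (hc₁ : 0 < c₁)
    {z w : TangentBundle 𝓘(ℝ, E) M} (h : S w ≤ S z) :
    K w ≤ c₂ ^ (1 / p) / c₁ ^ (1 / p) * K z := by
  rw [div_mul_eq_mul_div, le_div_iff₀ (Real.rpow_pos_of_pos hc₁ _), mul_comm]
  exact (hS.le_rpow w).trans ((Real.rpow_le_rpow (hS.S_nonneg w) h
    (one_div_pos.2 hS.p_pos).le).trans (hS.rpow_le z))

end IsDifferentialStorage

end Storage

end DiffDissipativity

end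
-- Assembly of the theorem
theorem mainTheorem1
    {E : Type*} [NormedAddCommGroup E] [NormedSpace ℝ E] [FiniteDimensional ℝ E]
    {M : Type*} [TopologicalSpace M] [ChartedSpace E M] [IsManifold 𝓘(ℝ, E) ∞ M] [T2Space M]
    {E₁ : Type*} [NormedAddCommGroup E₁] [NormedSpace ℝ E₁] [FiniteDimensional ℝ E₁]
    {U : Type*} [TopologicalSpace U] [ChartedSpace E₁ U] [IsManifold 𝓘(ℝ, E₁) ∞ U]
    {E₂ : Type*} [NormedAddCommGroup E₂] [NormedSpace ℝ E₂] [FiniteDimensional ℝ E₂]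
    {Y : Type*} [TopologicalSpace Y] [ChartedSpace E₂ Y] [IsManifold 𝓘(ℝ, E₂) ∞ Y]
    {m : ℕ} (F : TangentBundle 𝓘(ℝ, E) M × (U × Y) → EuclideanSpace ℝ (Fin m))
    (hF : ContMDiff (𝓘(ℝ, E).tangent.prod (𝓘(ℝ, E₁).prod 𝓘(ℝ, E₂)))
      𝓘(ℝ, EuclideanSpace ℝ (Fin m)) 1 F)
    (J : Set ℝ) (hJ : J = Set.univ ∨ J = Set.Ici 0)
    (hwp : DiffDissipativity.IsWellPosed E₁ E₂ F J)
    (Ω : Set M) (V H : (x : M) → Submodule ℝ (TangentSpace 𝓘(ℝ, E) x))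
    (S K : TangentBundle 𝓘(ℝ, E) M → ℝ) (p c₁ c₂ : ℝ)
    (hS : DiffDissipativity.IsDifferentialStorage Ω V H S K p c₁ c₂)
    (Q : M → TangentBundle 𝓘(ℝ, E₁) U → TangentBundle 𝓘(ℝ, E₂) Y → ℝ)
    (hQ : DiffDissipativity.IsDifferentialSupplyRate F J Q)
    (hdiss : DiffDissipativity.IsDissipationInequality F J S Q)
    (hQ0 : ∀ (x : M) (u : U) (ν : TangentBundle 𝓘(ℝ, E₂) Y), Q x ⟨u, 0⟩ ν = 0) :
    -- incremental stability for the pseudo-distance induced by `S^(1/p)`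
    DiffDissipativity.IsIncrementallyStable E₁ E₂ F J
      (DiffDissipativity.inducedDist fun ξ => S ξ ^ (1 / p)) ∧
    -- it is a pseudo-distance if `p` is the degree of homogeneity of `S`
    (DiffDissipativity.IsHomogeneousOfDegree H S p →
      DiffDissipativity.IsPseudoDistance
        (DiffDissipativity.inducedDist fun ξ => S ξ ^ (1 / p))) ∧
    -- it separates points if the horizontal distribution is the whole tangent space
    (0 < c₁ → (∀ x, H x = ⊤) →
      DiffDissipativity.Separates
        (DiffDissipativity.inducedDist fun ξ => S ξ ^ (1 / p))) ∧
    -- the same for the pseudo-distance induced by `K`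
    (0 < c₁ → DiffDissipativity.IsIncrementallyStable E₁ E₂ F J
      (DiffDissipativity.inducedDist K)) ∧
    DiffDissipativity.IsPseudoDistance (DiffDissipativity.inducedDist K) ∧
    ((∀ x, H x = ⊤) →
      DiffDissipativity.Separates (DiffDissipativity.inducedDist K)) := by
  have hJ0 : Ici 0 ⊆ J := by
    rcases hJ with rfl | rfl
    · exact subset_univ _
    · exact Subset.rfl
  refine ⟨?_, fun hhom => ?_, fun hc₁ hH a b hab => ?_, fun hc₁ => ?_, ?_, hS.separates_K⟩
  · refine DiffDissipativity.isIncrementallyStable_inducedDist hF hJ0 hwp hdiss hQ0 one_pos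
      fun z w h => ?_
    rw [NNReal.coe_one, one_mul]
    exact Real.rpow_le_rpow (hS.S_nonneg w) h (one_div_pos.2 hS.p_pos).le
  · exact DiffDissipativity.isPseudoDistance_inducedDist (hS.isPosHomogeneous_rpow hhom)
      hS.isLocallyBounded_rpow
  · refine hS.separates_K hH a b ?_
    have hc := Real.rpow_pos_of_pos hc₁ (1 / p)
    have h := DiffDissipativity.const_mul_inducedDist_le hc hS.le_rpow a b
    rw [hab, nonpos_iff_eq_zero, mul_eq_zero] at h
    exact h.resolve_left (ENNReal.ofReal_pos.2 hc).ne'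
  · refine DiffDissipativity.isIncrementallyStable_inducedDist hF hJ0 hwp hdiss hQ0
      -- The natural constant `(c₂/c₁)^(1/p)` is zero when `c₂ = 0`; the maximum with `1` keeps `r ↦
      -- L * r` strictly increasing.
      (L := max 1 (c₂ ^ (1 / p) / c₁ ^ (1 / p)).toNNReal) (lt_max_of_lt_left one_pos)
      fun z w h => (hS.K_le_of_S_le hc₁ h).trans ?_
    refine mul_le_mul_of_nonneg_right ?_ (hS.K_nonneg z)
    exact (Real.le_coe_toNNReal _).trans (NNReal.coe_le_coe.2 (le_max_right _ _))
  · exact DiffDissipativity.isPseudoDistance_inducedDist hS.isPosHomogeneous_K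
      hS.isLocallyBounded_K
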